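/- Let $A$ be a commutative ring, let $R$ be a commutative $A$-algebra, and let $n\ge 1$. Let $\mathfrak S_n$ act on the $n$-fold tensor product $T=R\otimes_A\cdots\otimes_A R$ by permuting the factors, let $\mathfrak S_{n-1}\subseteq\mathfrak S_n$ be the subgroup fixing the last factor, and put $TS=T^{\mathfrak S_n}\subseteq TS'=T^{\mathfrak S_{n-1}}$. Let $\alpha:T\to T$ be the $A$-linear map with $$\alpha(x_1\otimes\cdots\otimes x_n)=\sum_{\sigma\in\mathfrak S_n}\operatorname{sgn}(\sigma)\,x_{\sigma(1)}\otimes\cdots\otimes x_{\sigma(n)},$$ and let $I_R\subseteq TS$ be the ideal generated by all products $\alpha(y)\alpha(z)$ with $y,z\in T$. For an $n$-tuple $x=(x_1,\dots,x_n)$ of elements of $R$ put $\alpha^2(x)=\alpha(x_1\otimes\cdots\otimes x_n)^2\in I_R$, and let $\mathscr A_+(\alpha^2(x))$ and $\mathscr R_+(\alpha^2(x))$ denote the degree zero parts of the localizations of the blow-up algebras $\bigoplus_{m\ge0}I_R^m$ and $\bigoplus_{m\ge0}I_R^m\,TS'$ at the degree one element $\alpha^2(x)$. Define the open subschemes $$\mathscr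 U^+_R=\bigcup_x\operatorname{Spec}\mathscr A_+(\alpha^2(x))\subseteq\operatorname{Proj}\Bigl(\bigoplus_{m\ge0}I_R^m\Bigr),\qquad \mathscr Z^+_R=\bigcup_x\operatorname{Spec}\mathscr R_+(\alpha^2(x))\subseteq\operatorname{Proj}\Bigl(\bigoplus_{m\ge0}I_R^m\,TS'\Bigr),$$ where $x$ runs over all $n$-tuples of elements of $R$. The inclusion $TS\subseteq TS'$ induces a morphism $\mathscr Z^+_R\to\mathscr U^+_R$, and the homomorphism $R\to TS'$, $z\mapsto 1\otimes\cdots\otimes1\otimes z$, induces a morphism $\mathscr Z^+_R\to\operatorname{Spec}R$. Let $B$ be a commutative $A$-algebra and let $E$ be a quotient $B$-algebra of $R\otimes_A B$ such that $B\to E$ is generically étale of rank $n$; that is, $E$ is a locally free $B$-module of rank $n$, and for the members $\operatorname{Spec}B_b$ of some open cover of $\operatorname{Spec}B$ by basic open subsets, the localization $E_b$ has a $B_b$-basis $e_1,\dots,e_n$ whose discriminant $\det(\operatorname{Tr}(e_ie_j))$ is a non-zero-divisor in $B_b$. Then $\mathscr U^+_R=\operatorname{Proj}\bigl(\bigoplus_{m\ge0}I_R^m\bigr)$,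 and there is a unique morphism of schemes $\mathfrak n^+:\operatorname{Spec}B\to\mathscr U^+_R$ such that the pull-back of $\mathscr Z^+_R$ along $\mathfrak n^+$ is $\operatorname{Spec}E$, i.e. such that there is a cartesian square $$\begin{array}{ccc}\operatorname{Spec}E&\longrightarrow&\mathscr Z^+_R\\ \downarrow&&\downarrow\\ \operatorname{Spec}B&\xrightarrow{\ \mathfrak n^+\ }&\mathscr U^+_R\end{array}$$ in which the composite $\operatorname{Spec}E\to\mathscr Z^+_R\to\operatorname{Spec}R$ is the morphism given by $R\to R\otimes_AB\to E$. Moreover $\mathfrak n^+$ is a morphism over $\operatorname{Spec}A$. -/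

import Mathlib

open CategoryTheory CategoryTheory.Limits AlgebraicGeometry
open scoped TensorProduct

universe u

noncomputable section

namespace GenericallyEtale


/-! ### Tensors, invariant tensors and the alternator -/

section Tensors

variable (A : Type u) [CommRing A] (R : Type u) [CommRing R] [Algebra A R] (n : ℕ)

/-- The `n`-fold tensor product `T^n_A R = R ⊗_A ⋯ ⊗_A R`, a commutative `A`-algebra. -/
abbrev TensorPow : Type u := ⨂[A] _ : Fin n, R

variable {n}

/-- Permutation of the tensor factors,
`x_1 ⊗ ⋯ ⊗ x_n ↦ x_{σ(1)} ⊗ ⋯ ⊗ x_{σ(n)}`, as an endomorphism of the `A`-algebra `T^n_A R`. -/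
def permute (σ : Equiv.Perm (Fin n)) : TensorPow A R n →ₐ[A] TensorPow A R n :=
  PiTensorProduct.liftAlgHom
    ((PiTensorProduct.tprod A (s := fun _ : Fin n => R)).domDomCongr σ)
    (by simp [MultilinearMap.domDomCongr_apply, PiTensorProduct.one_def]; rfl)
    (fun x y => by
      simp only [MultilinearMap.domDomCongr_apply, PiTensorProduct.tprod_mul_tprod]; rfl)

@[simp]
theorem permute_tprod (σ : Equiv.Perm (Fin n)) (x : Fin n → R) :
    permute A R σ (PiTensorProduct.tprod A x) = PiTensorProduct.tprod A (fun i => x (σ i)) := by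
  simp [permute, MultilinearMap.domDomCongr_apply]

theorem permute_permute (σ τ : Equiv.Perm (Fin n)) (t : TensorPow A R n) :
    permute A R τ (permute A R σ t) = permute A R (σ * τ) t := by
  induction t using PiTensorProduct.induction_on with
  | smul_tprod r x => simp
  | add x y hx hy => simp [hx, hy]

/-- The `A`-algebra of tensors that are invariant under a group of permutations of the factors. -/
def invariants (H : Subgroup (Equiv.Perm (Fin n))) : Subalgebra A (TensorPow A R n) where
  carrier := {t | ∀ σ ∈ H, permute A R σ t = t}
  mul_mem' hx hy σ hσ := by rw [map_mul, hx σ hσ, hy σ hσ]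
  add_mem' hx hy σ hσ := by rw [map_add, hx σ hσ, hy σ hσ]
  algebraMap_mem' a σ _ := (permute A R σ).commutes a

variable (n)

/-- The algebra of symmetric tensors `TS^n_A R = (T^n_A R)^{𝔖_n}`. -/
abbrev SymTensor : Subalgebra A (TensorPow A R n) := invariants A R ⊤

/-- The algebra `TS^{n-1,1}_A R = (T^n_A R)^{𝔖_{n-1}}`, where `𝔖_{n-1}` permutes the first `n - 1`
factors, i.e. it is the group of permutations that fix the last index `⊤ : Fin n`. -/
abbrev SymTensor' [NeZero n] : Subalgebra A (TensorPow A R n) :=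
  invariants A R (MulAction.stabilizer (Equiv.Perm (Fin n)) (⊤ : Fin n))

/-- The inclusion `TS^n_A R ⊆ TS^{n-1,1}_A R`. -/
def symInclusion [NeZero n] : SymTensor A R n →ₐ[A] SymTensor' A R n :=
  Subalgebra.inclusion fun _ ht σ _ => ht σ (Subgroup.mem_top σ)

/-- The co-projection on the last factor, `z ↦ 1 ⊗ ⋯ ⊗ 1 ⊗ z`, as a map `R → TS^{n-1,1}_A R`. -/
def lastCoproj [NeZero n] : R →ₐ[A] SymTensor' A R n :=
  (PiTensorProduct.singleAlgHom (R := A) (A := fun _ : Fin n => R) (⊤ : Fin n)).codRestrict _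
    fun z σ hσ => by
      rw [PiTensorProduct.singleAlgHom_apply, permute_tprod]
      congr 1
      funext i
      have h : σ ⊤ = ⊤ := hσ
      by_cases hi : i = ⊤
      · subst hi; rw [h]
      · have hi' : σ i ≠ ⊤ := fun e => hi (σ.injective (e.trans h.symm))
        simp [Pi.mulSingle_eq_of_ne hi, Pi.mulSingle_eq_of_ne hi']

/-- The alternator `α : T^n_A R → T^n_A R`,
`α(x_1 ⊗ ⋯ ⊗ x_n) = ∑_σ sign(σ) x_{σ(1)} ⊗ ⋯ ⊗ x_{σ(n)}`. -/
def alternator : TensorPow A R n →ₗ[A] TensorPow A R n :=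
  ∑ σ : Equiv.Perm (Fin n), ((Equiv.Perm.sign σ : ℤ) : A) • (permute A R σ).toLinearMap

theorem alternator_apply (t : TensorPow A R n) :
    alternator A R n t =
      ∑ σ : Equiv.Perm (Fin n), ((Equiv.Perm.sign σ : ℤ) : A) • permute A R σ t := by
  rw [alternator, LinearMap.sum_apply]; rfl

theorem sign_mul_sign (σ : Equiv.Perm (Fin n)) :
    ((Equiv.Perm.sign σ : ℤ) : A) * ((Equiv.Perm.sign σ : ℤ) : A) = 1 := by
  rw [← Int.cast_mul, ← Units.val_mul, Int.units_mul_self, Units.val_one, Int.cast_one]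

theorem permute_alternator (τ : Equiv.Perm (Fin n)) (t : TensorPow A R n) :
    permute A R τ (alternator A R n t) =
      ((Equiv.Perm.sign τ : ℤ) : A) • alternator A R n t := by
  simp only [alternator_apply, map_sum, map_smul, permute_permute, Finset.smul_sum, smul_smul]
  refine Fintype.sum_equiv (Equiv.mulRight τ) _ _ fun σ => ?_
  simp only [Equiv.coe_mulRight, Equiv.Perm.sign_mul, Units.val_mul, Int.cast_mul]
  rw [mul_comm ((Equiv.Perm.sign σ : ℤ) : A), ← mul_assoc, sign_mul_sign, one_mul]

variable {n}

/-- The product `α(y) α(z)` of two alternating tensors, which is a symmetric tensor. -/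
def altMul (y z : TensorPow A R n) : SymTensor A R n :=
  ⟨alternator A R n y * alternator A R n z, fun σ _ => by
    rw [map_mul, permute_alternator, permute_alternator, smul_mul_smul_comm, sign_mul_sign,
      one_smul]⟩

/-- The symmetric tensor `α²(x) = α(x_1 ⊗ ⋯ ⊗ x_n)²` of an `n`-tuple `x` of elements of `R`. -/
def altSq (x : Fin n → R) : SymTensor A R n :=
  altMul A R (PiTensorProduct.tprod A x) (PiTensorProduct.tprod A x)

variable (n)

/-- The canonical ideal `I_R ⊆ TS^n_A R`: the image of `y ⊗ z ↦ α(y) α(z)`. -/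
def canonicalIdeal : Ideal (SymTensor A R n) :=
  Ideal.span (Set.range fun p : TensorPow A R n × TensorPow A R n => altMul A R p.1 p.2)

theorem altSq_mem (x : Fin n → R) : altSq A R x ∈ canonicalIdeal A R n :=
  Ideal.subset_span ⟨(_, _), rfl⟩

end Tensors

/-! ### The blow-up algebra `⊕_{m ≥ 0} I^m` as a graded ring

It is Mathlib's `reesAlgebra I`, the subalgebra of polynomials `∑ a_m t^m` with `a_m ∈ I^m`. -/

section Rees

variable {S : Type u} [CommRing S] (I : Ideal S)

/-- The degree `m` part `I^m t^m` of the blow-up algebra. -/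
def reesGrading (m : ℕ) : Submodule S (reesAlgebra I) :=
  (LinearMap.range (Polynomial.monomial m : S →ₗ[S] Polynomial S)).comap
    (reesAlgebra I).val.toLinearMap

variable {I} in
/-- The element `a t^m` for `a ∈ I^m`. -/
def reesMonomial (m : ℕ) (a : S) (ha : a ∈ I ^ m) : reesAlgebra I :=
  ⟨Polynomial.monomial m a, reesAlgebra.monomial_mem.mpr ha⟩

variable {I} in
theorem reesMonomial_mem (m : ℕ) (a : S) (ha : a ∈ I ^ m) :
    reesMonomial m a ha ∈ reesGrading I m := ⟨a, rfl⟩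

variable {I} in
theorem mem_reesGrading_iff {m : ℕ} {f : reesAlgebra I} :
    f ∈ reesGrading I m ↔ ∃ (a : S) (ha : a ∈ I ^ m), reesMonomial m a ha = f := by
  constructor
  · rintro ⟨a, ha⟩
    have ha' : Polynomial.monomial m a = (f : Polynomial S) := ha
    exact ⟨a, reesAlgebra.monomial_mem.mp (ha' ▸ f.2), Subtype.ext ha'⟩
  · rintro ⟨a, ha, rfl⟩
    exact reesMonomial_mem m a ha

instance : SetLike.GradedMonoid (reesGrading I) where
  one_mem := ⟨1, rfl⟩
  mul_mem := by
    rintro i j _ _ ⟨a, ha⟩ ⟨b, hb⟩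
    exact ⟨a * b, by
      rw [← Polynomial.monomial_mul_monomial, ha, hb]; rfl⟩

variable {I} in
theorem coeff_of_mem {i : ℕ} {f : reesAlgebra I} (hf : f ∈ reesGrading I i) (j : ℕ) :
    (f : Polynomial S).coeff j = if i = j then (f : Polynomial S).coeff i else 0 := by
  obtain ⟨a, ha, rfl⟩ := mem_reesGrading_iff.mp hf
  simp [reesMonomial, Polynomial.coeff_monomial]

/-- The homogeneous component of degree `m`. -/
def reesComponent (m : ℕ) (f : reesAlgebra I) : reesGrading I m :=
  ⟨reesMonomial m ((f : Polynomial S).coeff m) (f.2 m), reesMonomial_mem ..⟩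

theorem coeff_coeAddMonoidHom (x : DirectSum ℕ fun i => reesGrading I i) (j : ℕ) :
    ((DirectSum.coeAddMonoidHom (reesGrading I) x : reesAlgebra I) : Polynomial S).coeff j =
      ((x j : reesAlgebra I) : Polynomial S).coeff j := by
  induction x using DirectSum.induction_on with
  | zero => simp
  | of i y =>
    rw [DirectSum.coeAddMonoidHom_of, coeff_of_mem y.2, DirectSum.of_apply]
    split_ifs with h
    · subst h; rfl
    · rfl
  | add x y hx hy => simp [hx, hy]

instance : DirectSum.Decomposition (reesGrading I) where
  decompose' f := DirectSum.mk (fun i => reesGrading I i) (f : Polynomial S).support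
    fun i => reesComponent I i f
  left_inv f := by
    refine Subtype.ext (Polynomial.ext fun j => ?_)
    rw [coeff_coeAddMonoidHom]
    by_cases hj : j ∈ (f : Polynomial S).support
    · rw [DirectSum.mk_apply_of_mem hj]
      simp [reesComponent, reesMonomial]
    · rw [DirectSum.mk_apply_of_notMem hj]
      simpa using (Polynomial.notMem_support_iff.mp hj).symm
  right_inv x := by
    refine DFinsupp.ext fun j => Subtype.ext (Subtype.ext (Polynomial.ext fun k => ?_))
    by_cases hj : j ∈
        ((DirectSum.coeAddMonoidHom (reesGrading I) x : reesAlgebra I) : Polynomial S).support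
    · rw [DirectSum.mk_apply_of_mem hj, coeff_of_mem (x j).2]
      simp [reesComponent, reesMonomial, Polynomial.coeff_monomial, coeff_coeAddMonoidHom]
    · rw [DirectSum.mk_apply_of_notMem hj, coeff_of_mem (x j).2, ← coeff_coeAddMonoidHom,
        Polynomial.notMem_support_iff.mp hj]
      simp

instance : GradedRing (reesGrading I) where

/-- The element `a t` of degree one of the blow-up algebra, for `a ∈ I`. -/
def degOne (a : S) (ha : a ∈ I) : reesAlgebra I :=
  reesMonomial 1 a (by rwa [pow_one])

variable {S' : Type u} [CommRing S'] (φ : S →+* S')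

/-- The graded homomorphism `⊕ I^m → ⊕ (I S')^m = ⊕ I^m S'` induced by a ring
homomorphism `S → S'`. -/
def reesMap : reesGrading I →+*ᵍ reesGrading (I.map φ) where
  toRingHom := ((Polynomial.mapRingHom φ).comp (reesAlgebra I).val.toRingHom).codRestrict
    (reesAlgebra (I.map φ)) fun f i => by
      simpa [← Ideal.map_pow] using Ideal.mem_map_of_mem φ (f.2 i)
  map_mem := by
    rintro i _ ⟨a, ha⟩
    exact ⟨φ a, by
      change _ = Polynomial.map φ _
      rw [← Polynomial.map_monomial, ha]; rfl⟩

theorem reesMap_degOne (a : S) (ha : a ∈ I) :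
    reesMap I φ (degOne I a ha) = degOne (I.map φ) (φ a) (Ideal.mem_map_of_mem φ ha) :=
  Subtype.ext (Polynomial.map_monomial φ)

theorem irrelevant_le_map_reesMap :
    HomogeneousIdeal.irrelevant (reesGrading (I.map φ)) ≤
      (HomogeneousIdeal.irrelevant (reesGrading I)).map (reesMap I φ) := by
  refine toIdeal_le_toIdeal_iff.mp
    ((HomogeneousIdeal.toIdeal_irrelevant_le _).mpr fun i hi f hf => ?_)
  obtain ⟨a, ha, rfl⟩ := mem_reesGrading_iff.mp hf
  have key : ∀ b ∈ (I ^ i).map φ, ∃ h : b ∈ I.map φ ^ i, reesMonomial i b h ∈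
      ((HomogeneousIdeal.irrelevant (reesGrading I)).map (reesMap I φ)).toIdeal := by
    intro b hb
    refine Submodule.span_induction ?_ ?_ ?_ ?_ hb
    · rintro _ ⟨c, hc, rfl⟩
      refine ⟨by rw [← Ideal.map_pow]; exact Ideal.mem_map_of_mem φ hc, ?_⟩
      have e : reesMonomial i (φ c) (by rw [← Ideal.map_pow]; exact Ideal.mem_map_of_mem φ hc) =
          reesMap I φ (reesMonomial i c hc) := Subtype.ext (Polynomial.map_monomial φ).symm
      rw [e]
      refine Ideal.mem_map_of_mem (reesMap I φ) ?_
      exact HomogeneousIdeal.mem_irrelevant_of_mem _ hi (reesMonomial_mem i c hc)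
    · refine ⟨Ideal.zero_mem _, ?_⟩
      have e : reesMonomial i (0 : S') (Ideal.zero_mem (I.map φ ^ i)) = 0 :=
        Subtype.ext (map_zero _)
      rw [e]
      exact Ideal.zero_mem _
    · rintro x y - - ⟨hx, hx'⟩ ⟨hy, hy'⟩
      refine ⟨Ideal.add_mem _ hx hy, ?_⟩
      have e : reesMonomial i (x + y) (Ideal.add_mem _ hx hy) =
          reesMonomial i x hx + reesMonomial i y hy := Subtype.ext (map_add _ _ _)
      rw [e]
      exact Ideal.add_mem _ hx' hy'
    · rintro c x - ⟨hx, hx'⟩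
      refine ⟨Ideal.mul_mem_left _ c hx, ?_⟩
      have e : reesMonomial i (c • x) (Ideal.mul_mem_left _ c hx) =
          algebraMap S' _ c * reesMonomial i x hx := by
        rw [← Algebra.smul_def]
        exact Subtype.ext (map_smul _ _ _)
      rw [e]
      exact Ideal.mul_mem_left _ _ hx'
  obtain ⟨_, h⟩ := key a (by rwa [Ideal.map_pow])
  exact h

end Rees

/-! ### The universal family `𝒵⁺_R → 𝒰⁺_R` -/

section Family

variable (A : Type u) [CommRing A] (R : Type u) [CommRing R] [Algebra A R] (n : ℕ)

/-- `Proj (⊕_{m ≥ 0} I_R^m)`. -/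
abbrev blowUp : Scheme.{u} := Proj (reesGrading (canonicalIdeal A R n))

/-- The open subscheme `𝒰⁺_R = ⋃_x Spec 𝒜₊(α²(x))` of `Proj (⊕ I_R^m)`. Here
`Spec 𝒜₊(α²(x))`, the spectrum of the degree zero part of the localization of `⊕ I_R^m` at the
degree one element `α²(x)`, is the basic open subscheme of `Proj` defined by that element. -/
def uPlus : (blowUp A R n).Opens :=
  ⨆ x : Fin n → R, Proj.basicOpen (reesGrading (canonicalIdeal A R n))
    (degOne _ (altSq A R x) (altSq_mem A R n x))

/-- The structure morphism `𝒰⁺_R → Spec A`. -/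
def uPlusToBase : (uPlus A R n).toScheme ⟶ Spec (.of A) :=
  (uPlus A R n).ι ≫ Proj.toSpecZero (reesGrading (canonicalIdeal A R n)) ≫
    Spec.map (CommRingCat.ofHom
      ((algebraMap (SymTensor A R n) (reesGrading (canonicalIdeal A R n) 0)).comp
        (algebraMap A (SymTensor A R n))))

variable [NeZero n]

/-- The extension `I_R TS^{n-1,1}_A R` of the canonical ideal. -/
abbrev canonicalIdeal' : Ideal (SymTensor' A R n) :=
  (canonicalIdeal A R n).map (symInclusion A R n).toRingHom

theorem symInclusion_altSq_mem (x : Fin n → R) :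
    symInclusion A R n (altSq A R x) ∈ canonicalIdeal' A R n :=
  Ideal.mem_map_of_mem (symInclusion A R n).toRingHom (altSq_mem A R n x)

/-- `Proj (⊕_{m ≥ 0} I_R^m TS^{n-1,1}_A R)`. -/
abbrev blowUp' : Scheme.{u} := Proj (reesGrading (canonicalIdeal' A R n))

/-- The morphism `Proj (⊕ I_R^m TS^{n-1,1}_A R) → Proj (⊕ I_R^m)` induced by the inclusion
`TS^n_A R ⊆ TS^{n-1,1}_A R`. -/
def blowUpMap : blowUp' A R n ⟶ blowUp A R n :=
  Proj.map (reesMap (canonicalIdeal A R n) (symInclusion A R n).toRingHom)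
    (irrelevant_le_map_reesMap _ _)

/-- The scheme `𝒵⁺_R = ⋃_x Spec ℛ₊(α²(x))`, where `ℛ₊(α²(x))` is the degree zero part of the
localization of `⊕ I_R^m TS^{n-1,1}_A R` at the degree one element `α²(x)`. -/
def zPlus : (blowUp' A R n).Opens :=
  ⨆ x : Fin n → R, Proj.basicOpen (reesGrading (canonicalIdeal' A R n))
    (degOne _ (symInclusion A R n (altSq A R x)) (symInclusion_altSq_mem A R n x))

theorem zPlus_le : zPlus A R n ≤ blowUpMap A R n ⁻¹ᵁ uPlus A R n := by
  refine iSup_le fun x => ?_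
  have h : Proj.basicOpen (reesGrading (canonicalIdeal' A R n))
      (degOne _ (symInclusion A R n (altSq A R x)) (symInclusion_altSq_mem A R n x)) =
      blowUpMap A R n ⁻¹ᵁ Proj.basicOpen (reesGrading (canonicalIdeal A R n))
        (degOne _ (altSq A R x) (altSq_mem A R n x)) := by
    rw [blowUpMap, Proj.map_preimage_basicOpen, reesMap_degOne]
    rfl
  rw [h]
  exact (TopologicalSpace.Opens.map (blowUpMap A R n).base).monotone
    (le_iSup (fun x : Fin n → R => Proj.basicOpen (reesGrading (canonicalIdeal A R n))
      (degOne _ (altSq A R x) (altSq_mem A R n x))) x)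

/-- The family `𝒵⁺_R → 𝒰⁺_R`, given locally by `𝒜₊(α²(x)) → ℛ₊(α²(x))`. -/
def zPlusToUPlus : (zPlus A R n).toScheme ⟶ (uPlus A R n).toScheme :=
  (blowUpMap A R n).resLE (uPlus A R n) (zPlus A R n) (zPlus_le A R n)

/-- The morphism `𝒵⁺_R → Spec R` given locally by the `R`-algebra structure on `ℛ₊(α²(x))` that
comes from the co-projection `R → TS^{n-1,1}_A R` on the last factor. -/
def zPlusToSpec : (zPlus A R n).toScheme ⟶ Spec (.of R) :=
  (zPlus A R n).ι ≫ Proj.toSpecZero (reesGrading (canonicalIdeal' A R n)) ≫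
    Spec.map (CommRingCat.ofHom
      ((algebraMap (SymTensor' A R n) (reesGrading (canonicalIdeal' A R n) 0)).comp
        (lastCoproj A R n).toRingHom))

end Family

/-! ### Generically étale extensions -/

/-- A `B`-algebra `E` is generically étale of rank `n` if it is locally free of rank `n`, and if the
local generators of the discriminant ideal are non-zero-divisors: `Spec B` is covered by open
subsets `D(b)` such that `E_b` has a `B_b`-basis `e_1, …, e_n` whose discriminant
`det (Tr (e_i e_j))` is a non-zero-divisor in `B_b`. -/
def IsGenericallyEtale (n : ℕ) (B E : Type u) [CommRing B] [CommRing E] [Algebra B E] : Prop :=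
  ∃ s : Set B, Ideal.span s = ⊤ ∧ ∀ b ∈ s,
    ∃ e : Module.Basis (Fin n) (Localization.Away b) (Localization.Away b ⊗[B] E),
      Algebra.discr (Localization.Away b) e ∈ nonZeroDivisors (Localization.Away b)

/-! ### Pull-backs of the universal family -/

/-- Let `E` be a `B`-algebra and `ρ : R → E` a ring homomorphism. The pull-back of the family
`𝒵⁺_R → 𝒰⁺_R` along `f : Spec B → 𝒰⁺_R`, together with its morphism to `Spec R`, is
`Spec E → Spec B` together with `Spec ρ : Spec E → Spec R`. -/
def PullsBackTo (A R : Type u) [CommRing A] [CommRing R] [Algebra A R] (n : ℕ) [NeZero n]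
    {B E : Type u} [CommRing B] [CommRing E] [Algebra B E] (ρ : R →+* E)
    (f : Spec (.of B) ⟶ (uPlus A R n).toScheme) : Prop :=
  ∃ g : Spec (.of E) ⟶ (zPlus A R n).toScheme,
    IsPullback g (Spec.map (CommRingCat.ofHom (algebraMap B E))) (zPlusToUPlus A R n) f ∧
    g ≫ zPlusToSpec A R n = Spec.map (CommRingCat.ofHom ρ)

end GenericallyEtale

end

noncomputable section

namespace GenericallyEtale

/-! ### Charts of a blow-up -/

section Charts

variable {S : Type u} [CommRing S] (I : Ideal S)

/-! Fix a tuple `x`. Both chart rings embed in the localization of the tensor power at `α²(x)`,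
where `α(x)` is a unit, and `α(u)` is the determinant of the matrix of conjugates of `u`
(`alternator_tprod`). Cramer's rule for this matrix shows that `ℛ₊(α²(x))` is free over `𝒜₊(α²(x))`
on the images of the `x i`, the `i`-th coordinate of `z : R` being `α(x with z in place i) / α(x)`.
Moreover `𝒜₊(α²(x))` is generated as a ring by the ratios `α(u) / α(x)` (`closure_ratio_tprod`).

Uniqueness. If `F` with `ρ : R → F` is the base change of the family along `φ : 𝒜₊(α²(x)) → C`, then
the `ρ (x i)` form a basis `e` of `F`, and `φ` must send `α(u) / α(x)` to the determinant of `ρ(u)`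
in the basis `e` (`det_ratio`); so `φ` is determined. If a second chart `x'` also serves, `α²(x') /
α²(x)` goes to the square of an invertible change-of-basis determinant, so both morphisms land in
one chart.

Existence. If the `ρ (x i)` form a basis `e` of `F`, symmetric tensors act on the line `C · α(e)`
through a character `symNorm`. It sends `α(y) α(z)` to `det(y) det(z) discr(e)`, so the canonical
ideal lands in the ideal generated by the discriminant. As this is a non-zero-divisor, division
gives `φ`, as in the universal property of a blow-up. Then `φ` matches the structure constants of
`ℛ₊(α²(x))` with those of `F`, so `F` is the base change.

Globally, `ρ(R)` spans `E`, so locally the determinants of the tuples `ρ(x)` generate the unit ideal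
and such bases exist on an open cover; uniqueness makes the local morphisms glue. Finally `(α(u)
α(v))² = α²(u) α²(v)` shows that the charts cover all of `Proj`. -/

theorem degOne_mem (d : S) (hd : d ∈ I) : degOne I d hd ∈ reesGrading I 1 :=
  reesMonomial_mem ..

/-- The degree zero part of the localization of the blow-up algebra at the degree one element
given by `d ∈ I`. -/
def Chart (d : S) (hd : d ∈ I) : Type u :=
  HomogeneousLocalization.Away (reesGrading I) (degOne I d hd)

instance (d : S) (hd : d ∈ I) : CommRing (Chart I d hd) :=
  inferInstanceAs (CommRing (HomogeneousLocalization.Away (reesGrading I) (degOne I d hd)))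

namespace Chart

variable {I} {d : S} {hd : d ∈ I}

/-- The inclusion of the chart in the localization of the blow-up algebra. -/
def val : Chart I d hd →+* Localization.Away (degOne I d hd) where
  toFun := HomogeneousLocalization.val
  map_one' := HomogeneousLocalization.val_one
  map_mul' := HomogeneousLocalization.val_mul
  map_zero' := HomogeneousLocalization.val_zero
  map_add' := HomogeneousLocalization.val_add

theorem val_injective : Function.Injective (val : Chart I d hd →+* _) :=
  HomogeneousLocalization.val_injective _

/-- The fraction `a / d ^ m`, where `a ∈ I ^ m`. -/
def frac (m : ℕ) (a : S) (ha : a ∈ I ^ m) : Chart I d hd :=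
  HomogeneousLocalization.Away.mk (reesGrading I) (degOne_mem I d hd) m (reesMonomial m a ha)
    (by rw [smul_eq_mul, mul_one]; exact reesMonomial_mem ..)

theorem exists_frac (z : Chart I d hd) : ∃ m a ha, frac m a ha = z := by
  obtain ⟨m, f, hf, rfl⟩ :=
    HomogeneousLocalization.Away.mk_surjective _ (degOne_mem I d hd) z
  have hf' := hf
  rw [smul_eq_mul, mul_one] at hf'
  obtain ⟨a, ha, rfl⟩ := mem_reesGrading_iff.mp hf'
  exact ⟨m, a, ha, rfl⟩

theorem val_frac (m : ℕ) (a : S) (ha : a ∈ I ^ m) :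
    val (frac (hd := hd) m a ha) =
      Localization.mk (reesMonomial m a ha)
        (⟨degOne I d hd ^ m, m, rfl⟩ : Submonoid.powers (degOne I d hd)) :=
  rfl

theorem frac_mul_frac {m m' : ℕ} {a a' : S} (ha : a ∈ I ^ m) (ha' : a' ∈ I ^ m') :
    (frac m a ha * frac m' a' ha' : Chart I d hd) =
      frac (m + m') (a * a') (by rw [pow_add]; exact Ideal.mul_mem_mul ha ha') := by
  apply val_injective
  rw [map_mul]
  simp only [val_frac, Localization.mk_mul]
  congr 1
  · exact Subtype.ext (Polynomial.monomial_mul_monomial _ _ _ _)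
  · exact Subtype.ext (pow_add _ _ _).symm

theorem frac_add_frac {m : ℕ} {a a' : S} (ha : a ∈ I ^ m) (ha' : a' ∈ I ^ m) :
    (frac m a ha + frac m a' ha' : Chart I d hd) = frac m (a + a') (Ideal.add_mem _ ha ha') := by
  apply val_injective
  rw [map_add]
  simp only [val_frac, Localization.add_mk_self]
  congr 1
  exact Subtype.ext (map_add (Polynomial.monomial m) _ _).symm

theorem frac_zero (m : ℕ) : (frac m 0 (zero_mem _) : Chart I d hd) = 0 := by
  have := frac_add_frac (hd := hd) (zero_mem (I ^ m)) (zero_mem (I ^ m))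
  simpa using this

variable {C : Type*} [CommRing C]

/-- A ring homomorphism on the blow-up algebra that sends the degree one element `d` to `1`
induces a ring homomorphism on the chart. -/
def lift (Θ : reesAlgebra I →+* C) (h : Θ (degOne I d hd) = 1) : Chart I d hd →+* C :=
  (Localization.awayLift Θ (degOne I d hd) (by simp [h])).comp val

theorem lift_frac (Θ : reesAlgebra I →+* C) (h : Θ (degOne I d hd) = 1) (m : ℕ) (a : S)
    (ha : a ∈ I ^ m) : lift Θ h (frac m a ha) = Θ (reesMonomial m a ha) := by
  rw [lift, RingHom.comp_apply, val_frac, Localization.awayLift_mk (v := 1)]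
  · simp
  · simp [h]

/-- If `v` is an inverse of the image of `d`, then `a / d ^ m ↦ a v ^ m` is a ring homomorphism. -/
def eval (φ : S →+* C) (v : C) (h : φ d * v = 1) : Chart I d hd →+* C :=
  lift ((Polynomial.eval₂RingHom φ v).comp (reesAlgebra I).val.toRingHom) (by
    change Polynomial.eval₂ φ v (Polynomial.monomial 1 d) = 1
    simpa using h)

theorem eval_frac (φ : S →+* C) (v : C) (h : φ d * v = 1) (m : ℕ) (a : S)
    (ha : a ∈ I ^ m) : eval φ v h (frac (hd := hd) m a ha) = φ a * v ^ m := by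
  rw [eval, lift_frac]
  change Polynomial.eval₂ φ v (Polynomial.monomial m a) = _
  simp

/-- As `φ d` is a unit, `a / d ^ m` can die only if `φ a = 0`; a power of `d` killing `a` then kills
the fraction already in the localized blow-up algebra. -/
theorem eval_injective (φ : S →+* C) (v : C) (h : φ d * v = 1)
    (hφ : ∀ a, φ a = 0 → ∃ p : ℕ, d ^ p * a = 0) :
    Function.Injective (eval φ v h : Chart I d hd →+* C) := by
  rw [injective_iff_map_eq_zero]
  intro z hz
  obtain ⟨m, a, ha, rfl⟩ := exists_frac z
  rw [eval_frac] at hz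
  have : φ a = 0 := by
    have := congrArg (· * φ d ^ m) hz
    simpa [mul_assoc, ← mul_pow, mul_comm v, h] using this
  obtain ⟨p, hp⟩ := hφ a this
  apply val_injective
  rw [val_frac, map_zero, Localization.mk_eq_mk', IsLocalization.mk'_eq_zero_iff]
  refine ⟨⟨degOne I d hd ^ p, p, rfl⟩, Subtype.ext ?_⟩
  change (Polynomial.monomial 1 d) ^ p * Polynomial.monomial m a = 0
  rw [Polynomial.monomial_pow, Polynomial.monomial_mul_monomial, hp, map_zero]

/-- The homomorphism from the ring `S` to the chart. -/
def ofBase : S →+* Chart I d hd :=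
  (HomogeneousLocalization.fromZeroRingHom (reesGrading I) _).comp
    (algebraMap S (reesGrading I 0))

theorem ofBase_eq_frac (a : S) :
    (ofBase a : Chart I d hd) = frac 0 a (by simp) := by
  apply val_injective
  rw [val_frac]
  change Localization.mk _ _ = _
  congr 1

theorem eval_ofBase (φ : S →+* C) (v : C) (h : φ d * v = 1) (a : S) :
    eval φ v h (ofBase a : Chart I d hd) = φ a := by
  rw [ofBase_eq_frac, eval_frac]
  simp

variable {S' : Type u} [CommRing S'] (φ : S →+* S')

variable (I d hd) in
theorem powers_degOne_le_comap : Submonoid.powers (degOne I d hd) ≤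
    (Submonoid.powers (degOne (I.map φ) (φ d) (Ideal.mem_map_of_mem φ hd))).comap
      (reesMap I φ) := by
  rintro _ ⟨m, rfl⟩
  exact ⟨m, by simp [reesMap_degOne]⟩

variable (I d hd) in
/-- The homomorphism of charts induced by a ring homomorphism `S → S'`. -/
def map : Chart I d hd →+* Chart (I.map φ) (φ d) (Ideal.mem_map_of_mem φ hd) :=
  HomogeneousLocalization.map (reesMap I φ) (powers_degOne_le_comap I d hd φ)

theorem map_frac (m : ℕ) (a : S) (ha : a ∈ I ^ m) :
    map I d hd φ (frac m a ha) =
      frac m (φ a) (by rw [← Ideal.map_pow]; exact Ideal.mem_map_of_mem φ ha) := by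
  apply val_injective
  rw [val_frac]
  refine (congrArg HomogeneousLocalization.val
    (HomogeneousLocalization.map_mk (reesMap I φ) (powers_degOne_le_comap I d hd φ) _)).trans ?_
  rw [HomogeneousLocalization.val_mk]
  congr 1
  · exact Subtype.ext (Polynomial.map_monomial φ)
  · refine Subtype.ext ?_
    change reesMap I φ (degOne I d hd ^ m) = _
    rw [map_pow, reesMap_degOne]

theorem eval_map (ψ : S' →+* C) (v : C) (h : ψ (φ d) * v = 1) (z : Chart I d hd) :
    eval ψ v h (map I d hd φ z) = eval (ψ.comp φ) v h z := by
  obtain ⟨m, a, ha, rfl⟩ := exists_frac z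
  rw [map_frac, eval_frac, eval_frac, RingHom.comp_apply]

/-- A chart is generated by the fractions of degree at most one. -/
theorem mem_subring
    (Q : Subring (Chart I d hd)) (h0 : ∀ a, ofBase a ∈ Q) {G : Set S} (hG : Ideal.span G = I)
    (h1 : ∀ a (ha : a ∈ G), frac 1 a (by rw [pow_one, ← hG]; exact Ideal.subset_span ha) ∈ Q)
    (z : Chart I d hd) : z ∈ Q := by
  obtain ⟨m, a, ha, rfl⟩ := exists_frac z
  induction m generalizing a with
  | zero => rw [← ofBase_eq_frac]; exact h0 a
  | succ m ih =>
    -- The membership proof is part of the claim because `frac` takes it as an argument while the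
    -- span induction varies `b`.
    have key : ∀ b ∈ I, ∃ hb : b ∈ I ^ 1, (frac 1 b hb : Chart I d hd) ∈ Q := by
      intro b hb
      rw [← hG] at hb
      refine Submodule.span_induction (fun c hc => ⟨_, h1 c hc⟩) ⟨zero_mem _, ?_⟩ ?_ ?_ hb
      · rw [frac_zero]
        exact Q.zero_mem
      · rintro b c - - ⟨hb, hb'⟩ ⟨hc, hc'⟩
        exact ⟨add_mem hb hc, by rw [← frac_add_frac hb hc]; exact Q.add_mem hb' hc'⟩
      · rintro s b - ⟨hb, hb'⟩
        refine ⟨Ideal.mul_mem_left _ s hb, ?_⟩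
        have := Q.mul_mem (h0 s) hb'
        rw [ofBase_eq_frac, frac_mul_frac] at this
        simpa only [zero_add, smul_eq_mul] using this
    have key' : ∀ b ∈ I ^ (m + 1), ∃ hb : b ∈ I ^ (m + 1),
        (frac (m + 1) b hb : Chart I d hd) ∈ Q := by
      intro b hb
      rw [pow_succ] at hb
      refine Submodule.mul_induction_on hb (fun s hs c hc => ?_) ?_
      · obtain ⟨hc', hcQ⟩ := key c hc
        have := Q.mul_mem (ih s hs) hcQ
        rw [frac_mul_frac] at this
        exact ⟨_, this⟩
      · rintro b c ⟨hb, hb'⟩ ⟨hc, hc'⟩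
        exact ⟨add_mem hb hc, by rw [← frac_add_frac hb hc]; exact Q.add_mem hb' hc'⟩
    exact (key' a ha).2

end Chart

end Charts

/-! ### The alternator as a determinant -/

section Determinants

variable (A : Type u) [CommRing A] {R : Type u} [CommRing R] [Algebra A R] {n : ℕ}

/-- The co-projection on the factor `j`. -/
def coproj (j : Fin n) : R →ₐ[A] TensorPow A R n :=
  PiTensorProduct.singleAlgHom (R := A) (A := fun _ : Fin n => R) j

theorem permute_coproj (σ : Equiv.Perm (Fin n)) (j : Fin n) (z : R) :
    permute A R σ (coproj A j z) = coproj A (σ⁻¹ j) z := by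
  rw [coproj, coproj, PiTensorProduct.singleAlgHom_apply, PiTensorProduct.singleAlgHom_apply,
    permute_tprod]
  congr 1
  funext i
  by_cases h : i = σ⁻¹ j
  · subst h; simp
  · have h' : σ i ≠ j := fun e => h (by simp [← e])
    exact (Pi.mulSingle_eq_of_ne (M := fun _ : Fin n => R) h' z).trans
      (Pi.mulSingle_eq_of_ne (M := fun _ : Fin n => R) h z).symm

theorem tprod_eq_prod_coproj (u : Fin n → R) :
    PiTensorProduct.tprod A u = ∏ i, coproj A i (u i) := by
  have h (i : Fin n) : coproj A i (u i) = PiTensorProduct.tprod A (Pi.mulSingle i (u i)) := rfl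
  simp only [h, ← PiTensorProduct.tprod_prod]
  congr 1
  exact (Finset.univ_prod_mulSingle u).symm

variable {A}

/-- A family of tensors indexed by the factors that is compatible with permutations. -/
def IsEquivariant (s : Fin n → TensorPow A R n) : Prop :=
  ∀ σ j, permute A R σ (s j) = s (σ⁻¹ j)

theorem isEquivariant_coproj (z : R) : IsEquivariant fun j : Fin n => coproj A j z :=
  fun σ j => permute_coproj A σ j z

/-- Leibniz formula: by equivariance, `σ` turns the diagonal product into the product along the
graph of `σ`. -/
theorem det_eq_alternator (w : Fin n → Fin n → TensorPow A R n) (hw : ∀ i, IsEquivariant (w i)) :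
    (Matrix.of w).det = alternator A R n (∏ i, w i i) := by
  rw [alternator_apply, Matrix.det_apply']
  refine Fintype.sum_equiv (Equiv.refl _) _ _ fun σ => ?_
  rw [Equiv.refl_apply, map_prod, Algebra.smul_def, map_intCast]
  congr 1
  refine Fintype.prod_equiv σ _ _ fun i => ?_
  rw [hw, Equiv.Perm.inv_def, Equiv.symm_apply_apply, Matrix.of_apply]

theorem alternator_tprod (u : Fin n → R) :
    alternator A R n (PiTensorProduct.tprod A u) =
      (Matrix.of fun i j => coproj A j (u i)).det := by
  rw [tprod_eq_prod_coproj, det_eq_alternator _ fun i => isEquivariant_coproj (u i)]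

theorem alternator_mul (a : SymTensor A R n) (y : TensorPow A R n) :
    alternator A R n ((a : TensorPow A R n) * y) = (a : TensorPow A R n) * alternator A R n y := by
  simp only [alternator_apply, map_mul, Finset.mul_sum, mul_smul_comm]
  exact Finset.sum_congr rfl fun σ _ => by rw [a.2 σ (Subgroup.mem_top σ)]

theorem altMul_mul (a : SymTensor A R n) (y z : TensorPow A R n) :
    altMul A R ((a : TensorPow A R n) * y) z = a * altMul A R y z := by
  refine Subtype.ext ?_
  change alternator A R n _ * _ = (a : TensorPow A R n) * (alternator A R n _ * _)
  rw [alternator_mul, mul_assoc]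

theorem altMul_mem (y z : TensorPow A R n) : altMul A R y z ∈ canonicalIdeal A R n :=
  Ideal.subset_span ⟨(y, z), rfl⟩

theorem altMul_add (y y' z : TensorPow A R n) :
    altMul A R (y + y') z = altMul A R y z + altMul A R y' z := by
  refine Subtype.ext ?_
  change alternator A R n _ * _ = alternator A R n _ * _ + alternator A R n _ * _
  rw [map_add, add_mul]

theorem altMul_comm (y z : TensorPow A R n) : altMul A R y z = altMul A R z y :=
  Subtype.ext (mul_comm _ _)

/-- With `y' = y` and `z' = z` this writes the square of `α(y) α(z)` as a product of two squares,
which is what makes the charts of the `α²(x)` cover `Proj`. -/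
theorem altMul_mul_altMul (y z y' z' : TensorPow A R n) :
    altMul A R y z * altMul A R y' z' = altMul A R y y' * altMul A R z z' :=
  Subtype.ext (mul_mul_mul_comm _ _ _ _)

/-- The factor-wise conjugates of a tensor that is invariant under the permutations of the
first `n - 1` factors. -/
def conj [NeZero n] (t : TensorPow A R n) (j : Fin n) : TensorPow A R n :=
  permute A R (Equiv.swap j ⊤) t

theorem conj_last [NeZero n] (t : TensorPow A R n) : conj t ⊤ = t := by
  rw [conj, Equiv.swap_self]
  induction t using PiTensorProduct.induction_on with
  | smul_tprod r x => simp
  | add x y hx hy => rw [map_add, hx, hy]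

theorem isEquivariant_conj [NeZero n] (t : SymTensor' A R n) :
    IsEquivariant (conj (t : TensorPow A R n)) := by
  intro σ j
  rw [conj, conj, permute_permute]
  -- The two permutations differ by a factor fixing `⊤`, which acts trivially on `t`.
  have h : Equiv.swap j ⊤ * σ =
      (Equiv.swap j ⊤ * σ * Equiv.swap (σ⁻¹ j) ⊤) * Equiv.swap (σ⁻¹ j) ⊤ := by
    rw [mul_assoc _ (Equiv.swap (σ⁻¹ j) ⊤), Equiv.swap_mul_self, mul_one]
  rw [h, ← permute_permute, t.2]
  change (Equiv.swap j ⊤ * σ * Equiv.swap (σ⁻¹ j) ⊤) ⊤ = ⊤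
  simp

theorem conj_lastCoproj [NeZero n] (z : R) (j : Fin n) :
    conj (lastCoproj A R n z : TensorPow A R n) j = coproj A j z := by
  change permute A R _ (coproj A ⊤ z) = _
  rw [permute_coproj]
  simp

/-- **Cramer's rule** for a tensor invariant under permutations of the first `n - 1` factors. -/
theorem cramer_conj [NeZero n] (x : Fin n → R) (t : SymTensor' A R n) (j : Fin n) :
    ∑ i, alternator A R n (∏ k, Function.update (fun k j => coproj A j (x k)) i
        (conj (t : TensorPow A R n)) k k) * coproj A j (x i) =
      alternator A R n (PiTensorProduct.tprod A x) * conj (t : TensorPow A R n) j := by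
  have h := Matrix.mulVec_cramer (Matrix.of fun i j => coproj A j (x i)).transpose
    (conj (t : TensorPow A R n))
  have h' := congrFun h j
  rw [Matrix.det_transpose, ← alternator_tprod, Pi.smul_apply, smul_eq_mul] at h'
  rw [← h', Matrix.mulVec, dotProduct]
  refine Finset.sum_congr rfl fun i _ => ?_
  rw [mul_comm, Matrix.transpose_apply, Matrix.of_apply, Matrix.cramer_transpose_apply,
    ← det_eq_alternator]
  · congr 2
  · intro k
    rcases eq_or_ne k i with rfl | hk
    · rw [Function.update_self]; exact isEquivariant_conj t
    · rw [Function.update_of_ne hk]; exact isEquivariant_coproj _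

theorem prod_update_coproj [NeZero n] (x : Fin n → R) (z : R) (i : Fin n) :
    ∏ k, Function.update (fun k j => coproj A j (x k)) i
        (conj (lastCoproj A R n z : TensorPow A R n)) k k =
      PiTensorProduct.tprod A (Function.update x i z) := by
  rw [tprod_eq_prod_coproj]
  refine Finset.prod_congr rfl fun k _ => ?_
  rcases eq_or_ne k i with rfl | hk
  · simp [conj_lastCoproj]
  · simp [hk]

end Determinants

/-! ### The algebra of the universal family over a chart -/

section FamilyCharts

variable (A : Type u) [CommRing A] {R : Type u} [CommRing R] [Algebra A R] {n : ℕ}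
  (x : Fin n → R)

/-- The ring `𝒜₊(α²(x))`. -/
abbrev BaseChart : Type u :=
  Chart (canonicalIdeal A R n) (altSq A R x) (altSq_mem A R n x)

/-- The localization of the tensor power at `α²(x)`. -/
abbrev TensorLoc : Type u :=
  Localization.Away (altSq A R x : TensorPow A R n)

/-- The inverse of `α²(x)`. -/
def locInv : TensorLoc A x := IsLocalization.Away.invSelf (altSq A R x : TensorPow A R n)

theorem mul_locInv :
    algebraMap (TensorPow A R n) (TensorLoc A x) (altSq A R x : TensorPow A R n) * locInv A x = 1 :=
  IsLocalization.Away.mul_invSelf _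

theorem coe_altSq : (altSq A R x : TensorPow A R n) =
    alternator A R n (PiTensorProduct.tprod A x) * alternator A R n (PiTensorProduct.tprod A x) :=
  rfl

theorem isUnit_alternator : IsUnit (algebraMap (TensorPow A R n) (TensorLoc A x)
    (alternator A R n (PiTensorProduct.tprod A x))) := by
  refine IsUnit.of_mul_eq_one (algebraMap (TensorPow A R n) (TensorLoc A x)
    (alternator A R n (PiTensorProduct.tprod A x)) * locInv A x) ?_
  rw [← mul_assoc, ← map_mul, ← coe_altSq, mul_locInv]

/-- The homomorphism from the algebra of symmetric tensors to the localized tensor power. -/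
def symToLoc : SymTensor A R n →+* TensorLoc A x :=
  (algebraMap (TensorPow A R n) (TensorLoc A x)).comp (SymTensor A R n).val.toRingHom

theorem symToLoc_apply (a : SymTensor A R n) :
    symToLoc A x a = algebraMap (TensorPow A R n) (TensorLoc A x) a := rfl

theorem symToLoc_mul_locInv : symToLoc A x (altSq A R x) * locInv A x = 1 := mul_locInv A x

/-- The embedding of `𝒜₊(α²(x))` into the localized tensor power. -/
def baseEmb : BaseChart A x →+* TensorLoc A x :=
  Chart.eval (symToLoc A x) (locInv A x) (symToLoc_mul_locInv A x)

/-- A tensor dies in the localization only if a power of `α²(x)` kills it, and that power is itself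
a symmetric tensor. -/
theorem baseEmb_injective : Function.Injective (baseEmb A x) := by
  refine Chart.eval_injective _ _ _ fun a ha => ?_
  have ha' : algebraMap (TensorPow A R n) (TensorLoc A x) a = 0 := ha
  rw [IsLocalization.map_eq_zero_iff (Submonoid.powers (altSq A R x : TensorPow A R n))] at ha'
  obtain ⟨⟨_, p, rfl⟩, hp⟩ := ha'
  exact ⟨p, Subtype.ext hp⟩

/-- The fraction `α(y) α(x) / α²(x)`. -/
def ratio (y : TensorPow A R n) : BaseChart A x :=
  Chart.frac 1 (altMul A R y (PiTensorProduct.tprod A x)) (by rw [pow_one]; exact altMul_mem _ _)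

theorem baseEmb_ratio_mul (y : TensorPow A R n) :
    baseEmb A x (ratio A x y) * algebraMap (TensorPow A R n) (TensorLoc A x)
      (alternator A R n (PiTensorProduct.tprod A x)) =
    algebraMap (TensorPow A R n) (TensorLoc A x) (alternator A R n y) := by
  rw [baseEmb, ratio, Chart.eval_frac, pow_one]
  change algebraMap (TensorPow A R n) (TensorLoc A x)
    (alternator A R n y * alternator A R n (PiTensorProduct.tprod A x)) * _ * _ = _
  rw [mul_right_comm, ← map_mul, mul_assoc, ← coe_altSq, map_mul, mul_assoc, mul_locInv, mul_one]

variable {A x} in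
-- Since `α(x)` is a unit in the localized tensor power, identities between ratios can be checked
-- after multiplying by it, where `ratio A x y` becomes `α(y)`.
theorem baseEmb_ext {z z' : BaseChart A x}
    (h : baseEmb A x z * algebraMap (TensorPow A R n) (TensorLoc A x)
        (alternator A R n (PiTensorProduct.tprod A x)) =
      baseEmb A x z' * algebraMap (TensorPow A R n) (TensorLoc A x)
        (alternator A R n (PiTensorProduct.tprod A x))) : z = z' :=
  baseEmb_injective A x ((isUnit_alternator A x).mul_left_injective h)

theorem baseEmb_ofBase (a : SymTensor A R n) :
    baseEmb A x (Chart.ofBase a) = algebraMap (TensorPow A R n) (TensorLoc A x) a :=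
  Chart.eval_ofBase _ _ _ _

theorem ratio_mul (a : SymTensor A R n) (y : TensorPow A R n) :
    ratio A x ((a : TensorPow A R n) * y) = Chart.ofBase a * ratio A x y := by
  refine baseEmb_ext ?_
  rw [baseEmb_ratio_mul, map_mul (baseEmb A x), mul_assoc, baseEmb_ratio_mul, alternator_mul,
    map_mul, baseEmb_ofBase]

theorem ratio_self : ratio A x (PiTensorProduct.tprod A x) = 1 := by
  refine baseEmb_ext ?_
  rw [baseEmb_ratio_mul, map_one, one_mul]

theorem ratio_add (y y' : TensorPow A R n) :
    ratio A x (y + y') = ratio A x y + ratio A x y' := by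
  refine baseEmb_ext ?_
  simp only [baseEmb_ratio_mul, map_add, add_mul]

theorem ratio_smul (a : A) (y : TensorPow A R n) :
    ratio A x (a • y) = Chart.ofBase (algebraMap A (SymTensor A R n) a) * ratio A x y := by
  rw [← ratio_mul, Algebra.smul_def]
  rfl

/-- The two factors `α(x)` in the numerators cancel one `α²(x)`. Hence every generator of the chart
in degree one is a product of two ratios. -/
theorem ratio_mul_ratio (y z : TensorPow A R n) :
    ratio A x y * ratio A x z =
      Chart.frac 1 (altMul A R y z) (by rw [pow_one]; exact altMul_mem _ _) := by
  refine baseEmb_ext ((isUnit_alternator A x).mul_left_injective ?_)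
  dsimp only
  rw [map_mul, mul_assoc, mul_mul_mul_comm, baseEmb_ratio_mul, baseEmb_ratio_mul,
    mul_assoc, ← map_mul, ← map_mul (algebraMap (TensorPow A R n) (TensorLoc A x)), ← coe_altSq,
    baseEmb, Chart.eval_frac, pow_one,
    mul_assoc, mul_comm (locInv A x), mul_locInv, mul_one, symToLoc_apply]
  rfl

theorem isUnit_permute_altSq (σ : Equiv.Perm (Fin n)) :
    IsUnit (((algebraMap (TensorPow A R n) (TensorLoc A x)).comp (permute A R σ).toRingHom)
      (altSq A R x : TensorPow A R n)) := by
  change IsUnit (algebraMap (TensorPow A R n) (TensorLoc A x)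
    (permute A R σ (altSq A R x : TensorPow A R n)))
  rw [(altSq A R x).2 σ (Subgroup.mem_top σ)]
  exact IsUnit.of_mul_eq_one _ (mul_locInv A x)

/-- The extension of a permutation of the factors to the localized tensor power. -/
def permuteLoc (σ : Equiv.Perm (Fin n)) : TensorLoc A x →+* TensorLoc A x :=
  Localization.awayLift
    ((algebraMap (TensorPow A R n) (TensorLoc A x)).comp (permute A R σ).toRingHom)
    (altSq A R x : TensorPow A R n) (isUnit_permute_altSq A x σ)

theorem permuteLoc_algebraMap (σ : Equiv.Perm (Fin n)) (t : TensorPow A R n) :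
    permuteLoc A x σ (algebraMap (TensorPow A R n) (TensorLoc A x) t) =
      algebraMap (TensorPow A R n) (TensorLoc A x) (permute A R σ t) :=
  IsLocalization.Away.lift_eq _ (isUnit_permute_altSq A x σ) _

theorem permuteLoc_locInv (σ : Equiv.Perm (Fin n)) :
    permuteLoc A x σ (locInv A x) = locInv A x := by
  have h := congrArg (permuteLoc A x σ) (mul_locInv A x)
  rw [map_mul, permuteLoc_algebraMap, (altSq A R x).2 σ (Subgroup.mem_top σ), map_one] at h
  have hu : IsUnit (algebraMap (TensorPow A R n) (TensorLoc A x)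
    (altSq A R x : TensorPow A R n)) := IsUnit.of_mul_eq_one _ (mul_locInv A x)
  exact hu.mul_right_injective (h.trans (mul_locInv A x).symm)

/-- Scalars from the base chart are symmetric, so a linear relation at the last factor can be
transported to every other factor. -/
theorem permuteLoc_baseEmb (σ : Equiv.Perm (Fin n)) (z : BaseChart A x) :
    permuteLoc A x σ (baseEmb A x z) = baseEmb A x z := by
  obtain ⟨m, a, ha, rfl⟩ := Chart.exists_frac z
  rw [baseEmb, Chart.eval_frac, map_mul, map_pow, permuteLoc_locInv, symToLoc_apply,
    permuteLoc_algebraMap, a.2 σ (Subgroup.mem_top σ)]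

/-- The ring `𝒜₊(α²(x))` is generated by the fractions `α(u₁ ⊗ ⋯ ⊗ uₙ) α(x) / α²(x)`. -/
theorem closure_ratio_tprod [NeZero n] :
    Subring.closure (Set.range fun u : Fin n → R => ratio A x (PiTensorProduct.tprod A u)) = ⊤ := by
  set Q := Subring.closure (Set.range fun u : Fin n → R => ratio A x (PiTensorProduct.tprod A u))
  have hpure (u : Fin n → R) : ratio A x (PiTensorProduct.tprod A u) ∈ Q :=
    Subring.subset_closure ⟨u, rfl⟩
  -- Scaling one entry of `x` by `a` scales `α(x)` by `a`, so `a` itself is a ratio of pure tensors;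
  -- an entry exists because `n` is nonzero.
  have hA (a : A) : Chart.ofBase (algebraMap A (SymTensor A R n) a) ∈ Q := by
    have := hpure (Function.update x ⊤ (a • x ⊤))
    rwa [MultilinearMap.map_update_smul, Function.update_eq_self, ratio_smul, ratio_self,
      mul_one] at this
  have hratio (y : TensorPow A R n) : ratio A x y ∈ Q := by
    induction y using PiTensorProduct.induction_on with
    | smul_tprod r u => rw [ratio_smul]; exact Q.mul_mem (hA r) (hpure u)
    | add y y' hy hy' => rw [ratio_add]; exact Q.add_mem hy hy'
  -- In degree zero, `a = α(a x) / α(x)` for a symmetric tensor `a`; in degree one,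
  -- `ratio_mul_ratio` applies.
  refine eq_top_iff.mpr fun z _ => Chart.mem_subring Q (fun a => ?_) rfl ?_ z
  · have := hratio ((a : TensorPow A R n) * PiTensorProduct.tprod A x)
    rwa [ratio_mul, ratio_self, mul_one] at this
  · rintro _ ⟨⟨y, z⟩, rfl⟩
    have := Q.mul_mem (hratio y) (hratio z)
    rwa [ratio_mul_ratio] at this

end FamilyCharts

/-! ### Freeness of the universal family over a chart. -/

section FamilyBasis

variable (A : Type u) [CommRing A] {R : Type u} [CommRing R] [Algebra A R] {n : ℕ} [NeZero n]
  (x : Fin n → R)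

/-- The ring `ℛ₊(α²(x))`. -/
abbrev FamilyChart : Type u :=
  Chart (canonicalIdeal' A R n) (symInclusion A R n (altSq A R x)) (symInclusion_altSq_mem A R n x)

/-- The homomorphism `𝒜₊(α²(x)) → ℛ₊(α²(x))`. -/
def chartHom : BaseChart A x →+* FamilyChart A x :=
  Chart.map (canonicalIdeal A R n) (altSq A R x) (altSq_mem A R n x) (symInclusion A R n).toRingHom

/-- The homomorphism `R → ℛ₊(α²(x))`. -/
def chartCoproj : R →+* FamilyChart A x :=
  Chart.ofBase.comp (lastCoproj A R n).toRingHom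

/-- The homomorphism from `TS^{n-1,1}` to the localized tensor power. -/
def symToLoc' : SymTensor' A R n →+* TensorLoc A x :=
  (algebraMap (TensorPow A R n) (TensorLoc A x)).comp (SymTensor' A R n).val.toRingHom

theorem symToLoc'_mul_locInv :
    symToLoc' A x (symInclusion A R n (altSq A R x)) * locInv A x = 1 := mul_locInv A x

/-- The embedding of `ℛ₊(α²(x))` into the localized tensor power. -/
def familyEmb : FamilyChart A x →+* TensorLoc A x :=
  Chart.eval (symToLoc' A x) (locInv A x) (symToLoc'_mul_locInv A x)

theorem familyEmb_injective : Function.Injective (familyEmb A x) := by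
  refine Chart.eval_injective _ _ _ fun a ha => ?_
  have ha' : algebraMap (TensorPow A R n) (TensorLoc A x) a = 0 := ha
  rw [IsLocalization.map_eq_zero_iff (Submonoid.powers (altSq A R x : TensorPow A R n))] at ha'
  obtain ⟨⟨_, p, rfl⟩, hp⟩ := ha'
  exact ⟨p, Subtype.ext hp⟩

theorem familyEmb_chartHom (z : BaseChart A x) :
    familyEmb A x (chartHom A x z) = baseEmb A x z :=
  Chart.eval_map _ _ _ _ _

theorem familyEmb_ofBase (t : SymTensor' A R n) :
    familyEmb A x (Chart.ofBase t) = algebraMap (TensorPow A R n) (TensorLoc A x) t :=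
  Chart.eval_ofBase _ _ _ _

theorem familyEmb_chartCoproj (z : R) :
    familyEmb A x (chartCoproj A x z) =
      algebraMap (TensorPow A R n) (TensorLoc A x) (coproj A ⊤ z) :=
  familyEmb_ofBase A x _

/-- Cramer's rule at the last factor, where `conj t ⊤ = t`, divided by the unit `α(x)`. -/
theorem ofBase_eq_sum (t : SymTensor' A R n) :
    (Chart.ofBase t : FamilyChart A x) =
      ∑ i, chartHom A x (ratio A x (∏ k, Function.update (fun k j => coproj A j (x k)) i
        (conj (t : TensorPow A R n)) k k)) * chartCoproj A x (x i) := by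
  refine familyEmb_injective A x ((isUnit_alternator A x).mul_left_injective ?_)
  simp only [map_sum, map_mul, familyEmb_chartHom, familyEmb_chartCoproj, familyEmb_ofBase,
    Finset.sum_mul]
  rw [mul_comm, ← map_mul]
  conv_lhs => rw [← conj_last (t : TensorPow A R n), ← cramer_conj, map_sum]
  refine Finset.sum_congr rfl fun i _ => ?_
  rw [map_mul, mul_right_comm, baseEmb_ratio_mul]

/-- The coordinates of the image of `z : R` in `ℛ₊(α²(x))`. -/
theorem chartCoproj_eq_sum (z : R) :
    chartCoproj A x z = ∑ i, chartHom A x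
      (ratio A x (PiTensorProduct.tprod A (Function.update x i z))) * chartCoproj A x (x i) := by
  simp only [← prod_update_coproj]
  exact ofBase_eq_sum A x (lastCoproj A R n z)

/-- The transpositions `(j ⊤)` fix the coefficients and spread the relation over all factors. The
resulting square system has the invertible determinant `α(x)`. -/
theorem eq_zero_of_sum_chartCoproj (c : Fin n → BaseChart A x)
    (h : ∑ i, chartHom A x (c i) * chartCoproj A x (x i) = 0) (i : Fin n) : c i = 0 := by
  have h1 := congrArg (familyEmb A x) h
  simp only [map_sum, map_mul, familyEmb_chartHom, familyEmb_chartCoproj, map_zero] at h1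
  have h2 : Matrix.vecMul (fun i => baseEmb A x (c i))
      ((Matrix.of fun i j => coproj A j (x i)).map
        (algebraMap (TensorPow A R n) (TensorLoc A x))) = 0 := by
    funext j
    have h3 := congrArg (permuteLoc A x (Equiv.swap j ⊤)) h1
    simp only [map_sum, map_mul, permuteLoc_baseEmb, permuteLoc_algebraMap, permute_coproj,
      map_zero, Equiv.swap_inv, Equiv.swap_apply_right] at h3
    exact h3
  have hdet : IsUnit ((Matrix.of fun i j => coproj A j (x i)).map
      (algebraMap (TensorPow A R n) (TensorLoc A x))).det := by
    rw [← RingHom.mapMatrix_apply, ← RingHom.map_det, ← alternator_tprod]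
    exact isUnit_alternator A x
  have h4 := congrArg (fun v => Matrix.vecMul v ((Matrix.of fun i j => coproj A j (x i)).map
      (algebraMap (TensorPow A R n) (TensorLoc A x)))⁻¹) h2
  simp only [Matrix.vecMul_vecMul, Matrix.mul_nonsing_inv _ hdet, Matrix.vecMul_one,
    Matrix.zero_vecMul] at h4
  refine baseEmb_injective A x ?_
  rw [map_zero]
  exact congrFun h4 i

/-- Every element of `ℛ₊(α²(x))` is a combination of the images of the `x i`. -/
theorem exists_sum_chartCoproj (z : FamilyChart A x) :
    ∃ c : Fin n → BaseChart A x, z = ∑ i, chartHom A x (c i) * chartCoproj A x (x i) := by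
  obtain ⟨m, a, ha, rfl⟩ := Chart.exists_frac z
  suffices h : ∃ ha : a ∈ canonicalIdeal' A R n ^ m, ∃ c : Fin n → BaseChart A x,
      (Chart.frac m a ha : FamilyChart A x) =
        ∑ i, chartHom A x (c i) * chartCoproj A x (x i) from h.2
  have ha' := ha
  rw [canonicalIdeal', ← Ideal.map_pow] at ha'
  refine Submodule.span_induction ?_ ⟨zero_mem _, 0, ?_⟩ ?_ ?_ ha'
  -- For `b` in the `m`-th power of the canonical ideal the fraction comes from the base chart, and
  -- it remains to expand `1` in the `x i`.
  · rintro _ ⟨b, hb, rfl⟩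
    have hb' : (symInclusion A R n).toRingHom b ∈ canonicalIdeal' A R n ^ m := by
      rw [canonicalIdeal', ← Ideal.map_pow]
      exact Ideal.mem_map_of_mem _ hb
    refine ⟨hb', fun i => Chart.frac m b hb *
      ratio A x (PiTensorProduct.tprod A (Function.update x i 1)), ?_⟩
    have h := Chart.map_frac (d := altSq A R x) (hd := altSq_mem A R n x)
      (symInclusion A R n).toRingHom m b hb
    have h1 := chartCoproj_eq_sum A x 1
    rw [map_one] at h1
    simp only [map_mul, mul_assoc]
    rw [← Finset.mul_sum, ← h1, mul_one]
    exact h.symm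
  · simp [Chart.frac_zero]
  · rintro b c - - ⟨hb, e, he⟩ ⟨hc, e', he'⟩
    refine ⟨add_mem hb hc, e + e', ?_⟩
    rw [← Chart.frac_add_frac hb hc, he, he', ← Finset.sum_add_distrib]
    simp [add_mul]
  -- The products `s * x i` again come from `TS^{n-1,1}`, so `ofBase_eq_sum` expands them.
  · rintro s b - ⟨hb, e, he⟩
    refine ⟨Ideal.mul_mem_left _ s hb, ?_⟩
    have h0 : (Chart.frac m (s • b) (Ideal.mul_mem_left _ s hb) : FamilyChart A x) =
        Chart.ofBase s * Chart.frac m b hb := by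
      rw [Chart.ofBase_eq_frac, Chart.frac_mul_frac]
      simp only [zero_add, smul_eq_mul]
    have h1 (i : Fin n) : ∃ e' : Fin n → BaseChart A x,
        Chart.ofBase s * chartCoproj A x (x i) =
          ∑ k, chartHom A x (e' k) * chartCoproj A x (x k) := by
      rw [chartCoproj, RingHom.comp_apply, ← map_mul]
      exact ⟨_, ofBase_eq_sum A x _⟩
    choose f hf using h1
    refine ⟨fun k => ∑ i, e i * f i k, ?_⟩
    rw [h0, he, Finset.mul_sum]
    simp only [mul_left_comm (Chart.ofBase s), hf, Finset.mul_sum, map_sum, map_mul,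
      Finset.sum_mul, mul_assoc]
    exact Finset.sum_comm

/-- The determinant of the coordinates of a tuple. -/
theorem det_ratio (u : Fin n → R) :
    (Matrix.of fun i k => ratio A x (PiTensorProduct.tprod A (Function.update x k (u i)))).det =
      ratio A x (PiTensorProduct.tprod A u) := by
  refine baseEmb_ext ?_
  -- By Cramer's rule for each `u i`, the coordinate matrix times the conjugate matrix of `x` is the
  -- conjugate matrix of `u`; the claim compares determinants.
  rw [baseEmb_ratio_mul, RingHom.map_det, alternator_tprod, alternator_tprod, RingHom.map_det,
    RingHom.map_det, ← Matrix.det_mul]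
  congr 1
  ext i j
  have h := cramer_conj (A := A) x (lastCoproj A R n (u i)) j
  simp only [prod_update_coproj, conj_lastCoproj] at h
  refine (isUnit_alternator A x).mul_right_injective ?_
  have h' := congrArg (algebraMap (TensorPow A R n) (TensorLoc A x)) h
  simp only [map_sum, map_mul] at h'
  simp only [RingHom.mapMatrix_apply, Matrix.mul_apply, Matrix.map_apply, Matrix.of_apply,
    Finset.mul_sum]
  rw [← h']
  refine Finset.sum_congr rfl fun k _ => ?_
  rw [← baseEmb_ratio_mul A x (PiTensorProduct.tprod A (Function.update x k (u i)))]
  ring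

end FamilyBasis

/-! ### Homomorphisms from a chart obtained by division -/

/-- The ideal `I ^ m` lands in the multiples of `ψ a₀ ^ m`, and `C` embeds in its localization at
the non-zero-divisor `ψ a₀`. So evaluation of the chart in the localization takes values in `C`. -/
theorem Chart.exists_hom_of_map_le {S : Type u} [CommRing S] {I : Ideal S} {a₀ : S} {h₀ : a₀ ∈ I}
    {C : Type*} [CommRing C] (ψ : S →+* C) (hd : ψ a₀ ∈ nonZeroDivisors C)
    (hI : I.map ψ ≤ Ideal.span {ψ a₀}) :
    ∃ Φ : Chart I a₀ h₀ →+* C, ∀ m a (ha : a ∈ I ^ m),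
      Φ (Chart.frac m a ha) * ψ a₀ ^ m = ψ a := by
  let K := Localization.Away (ψ a₀)
  let ι : C →+* K := algebraMap C K
  have hι : Function.Injective ι := IsLocalization.injective K (Submonoid.powers_le.mpr hd)
  let v : K := IsLocalization.Away.invSelf (ψ a₀)
  have hv : (ι.comp ψ) a₀ * v = 1 := IsLocalization.Away.mul_invSelf (S := K) (ψ a₀)
  let E : Chart I a₀ h₀ →+* K := Chart.eval (ι.comp ψ) v hv
  have hE (z : Chart I a₀ h₀) : ∃ c, ι c = E z := by
    obtain ⟨m, a, ha, rfl⟩ := Chart.exists_frac z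
    have h1 : ψ a ∈ Ideal.span {ψ a₀ ^ m} := by
      rw [← Ideal.span_singleton_pow]
      refine Ideal.pow_right_mono hI m ?_
      rw [← Ideal.map_pow]
      exact Ideal.mem_map_of_mem ψ ha
    obtain ⟨c, hc⟩ := Ideal.mem_span_singleton'.mp h1
    refine ⟨c, ?_⟩
    rw [Chart.eval_frac, RingHom.comp_apply, ← hc, map_mul, map_pow, mul_assoc, ← mul_pow]
    rw [RingHom.comp_apply] at hv
    rw [hv, one_pow, mul_one]
  choose Φ hΦ using hE
  refine ⟨⟨⟨⟨Φ, ?_⟩, ?_⟩, ?_, ?_⟩, fun m a ha => hι ?_⟩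
  · exact hι (by rw [hΦ, map_one, map_one])
  · exact fun z w => hι (by simp only [hΦ, map_mul])
  · exact hι (by simp only [hΦ, map_zero])
  · exact fun z w => hι (by simp only [hΦ, map_add])
  · change ι (Φ _ * _) = _
    rw [RingHom.comp_apply] at hv
    rw [map_mul, hΦ, Chart.eval_frac, map_pow, mul_assoc, ← mul_pow, mul_comm v, hv, one_pow,
      mul_one, RingHom.comp_apply]

/-! ### The action of symmetric tensors on the top exterior power -/

section Norm

variable {C F : Type u} [CommRing C] [CommRing F] [Algebra C F] {n : ℕ}
  (e : Module.Basis (Fin n) C F)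

/-- The linear form `y₁ ⊗ ⋯ ⊗ yₙ ↦ ∏ eᵢ*(yᵢ)`. -/
def coordForm : TensorPow C F n →ₗ[C] C :=
  PiTensorProduct.lift ((MultilinearMap.mkPiAlgebra C (Fin n) C).compLinearMap fun i => e.coord i)

theorem coordForm_tprod (u : Fin n → F) :
    coordForm e (PiTensorProduct.tprod C u) = ∏ i, e.repr (u i) i := by
  simp [coordForm]

/-- The linear form on the tensor power given by the determinant. -/
def detForm : TensorPow C F n →ₗ[C] C := coordForm e ∘ₗ alternator C F n

theorem detForm_tprod (u : Fin n → F) : detForm e (PiTensorProduct.tprod C u) = e.det u := by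
  rw [detForm, LinearMap.comp_apply, alternator_apply, e.det_apply, ← Matrix.det_transpose,
    Matrix.det_apply', map_sum]
  refine Finset.sum_congr rfl fun σ _ => ?_
  rw [map_smul, permute_tprod, coordForm_tprod, smul_eq_mul]
  rfl

/-- The conjugate matrix of `u` is the coordinate matrix of `u`, transposed, times the conjugate
matrix of `e`. Thus the image of the alternator is the line through `α(e)`. -/
theorem alternator_tprod_eq_smul (u : Fin n → F) :
    alternator C F n (PiTensorProduct.tprod C u) =
      e.det u • alternator C F n (PiTensorProduct.tprod C e) := by
  have h : (Matrix.of fun i j => (coproj C j (u i) : TensorPow C F n)) =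
      (e.toMatrix u).transpose.map (algebraMap C (TensorPow C F n)) *
        Matrix.of fun i j => coproj C j (e i) := by
    ext i j
    conv_lhs => rw [Matrix.of_apply, ← e.sum_repr (u i), map_sum]
    rw [Matrix.mul_apply]
    refine Finset.sum_congr rfl fun k _ => ?_
    rw [map_smul, Algebra.smul_def]
    rfl
  rw [alternator_tprod, h, Matrix.det_mul, ← alternator_tprod, ← RingHom.mapMatrix_apply,
    ← RingHom.map_det, Matrix.det_transpose, ← e.det_apply, Algebra.smul_def]

theorem alternator_eq_smul (y : TensorPow C F n) :
    alternator C F n y = detForm e y • alternator C F n (PiTensorProduct.tprod C e) := by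
  induction y using PiTensorProduct.induction_on with
  | smul_tprod r u =>
    rw [map_smul, map_smul, detForm_tprod, alternator_tprod_eq_smul e, smul_assoc]
  | add y y' hy hy' => rw [map_add, map_add, hy, hy', add_smul]

theorem detForm_tprod_self : detForm e (PiTensorProduct.tprod C e) = 1 := by
  rw [detForm_tprod, e.det_self]

theorem coordForm_alternator (y : TensorPow C F n) :
    coordForm e (alternator C F n y) = detForm e y := rfl

theorem mul_alternator_basis (a : SymTensor C F n) :
    (a : TensorPow C F n) * alternator C F n (PiTensorProduct.tprod C e) =
      detForm e ((a : TensorPow C F n) * PiTensorProduct.tprod C e) •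
        alternator C F n (PiTensorProduct.tprod C e) := by
  rw [← alternator_mul, ← alternator_eq_smul]

/-- The character through which symmetric tensors act on the top exterior power. -/
def symNorm : SymTensor C F n →+* C where
  toFun a := detForm e ((a : TensorPow C F n) * PiTensorProduct.tprod C e)
  map_one' := by rw [OneMemClass.coe_one, one_mul, detForm_tprod_self]
  map_zero' := by rw [ZeroMemClass.coe_zero, zero_mul, map_zero]
  map_add' a b := by rw [AddMemClass.coe_add, add_mul, map_add]
  -- On the line through `α(e)`, first `b` and then `a` act by their scalars; the form `coordForm e`
  -- reads the scalar off because it sends `α(e)` to `1`.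
  map_mul' a b := by
    rw [MulMemClass.coe_mul, ← coordForm_alternator, ← MulMemClass.coe_mul, alternator_mul,
      MulMemClass.coe_mul, mul_assoc, mul_alternator_basis e b, mul_smul_comm,
      mul_alternator_basis e a, map_smul, map_smul, coordForm_alternator, detForm_tprod_self,
      smul_eq_mul, smul_eq_mul, mul_one, mul_comm]

theorem symNorm_apply (a : SymTensor C F n) :
    symNorm e a = detForm e ((a : TensorPow C F n) * PiTensorProduct.tprod C e) := rfl

theorem symNorm_eq (a : SymTensor C F n) :
    symNorm e a =
      coordForm e ((a : TensorPow C F n) * alternator C F n (PiTensorProduct.tprod C e)) := by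
  rw [symNorm_apply, ← alternator_mul, coordForm_alternator]

/-- Both `α(y)` and `α(z)` are multiples of `α(e)`. Hence the image of the canonical ideal is
generated by the norm of `α²(e)`. -/
theorem symNorm_altMul (y z : TensorPow C F n) :
    symNorm e (altMul C F y z) = detForm e y * detForm e z * symNorm e (altSq C F e) := by
  simp only [symNorm_eq]
  change coordForm e (alternator C F n y * alternator C F n z * _) = _ *
    coordForm e (alternator C F n (PiTensorProduct.tprod C e) * _ * _)
  rw [alternator_eq_smul e y, alternator_eq_smul e z, smul_mul_smul_comm, smul_mul_assoc, map_smul,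
    smul_eq_mul]

variable (n) in
/-- The symmetric tensor `∑ 1 ⊗ ⋯ ⊗ z ⊗ ⋯ ⊗ 1`. -/
def sumCoproj (z : F) : SymTensor C F n :=
  ⟨∑ j, coproj C j z, fun σ _ => by
    rw [map_sum]
    simp only [permute_coproj]
    exact Fintype.sum_equiv σ⁻¹ _ _ fun _ => rfl⟩

theorem coproj_mul_tprod (j : Fin n) (z : F) (u : Fin n → F) :
    coproj C j z * PiTensorProduct.tprod C u =
      PiTensorProduct.tprod C (Function.update u j (z * u j)) := by
  change PiTensorProduct.tprod C (Pi.mulSingle (M := fun _ : Fin n => F) j z) * _ = _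
  rw [PiTensorProduct.tprod_mul_tprod]
  congr 1
  funext k
  rcases eq_or_ne k j with rfl | hk
  · simp
  · simp [hk]

/-- Replacing `e j` by `z * e j` in the basis gives a determinant equal to the `j`-th diagonal entry
of multiplication by `z`. -/
theorem symNorm_sumCoproj (z : F) : symNorm e (sumCoproj n z) = Algebra.trace C F z := by
  rw [symNorm_apply, Algebra.trace_eq_matrix_trace e, Matrix.trace]
  change detForm e ((∑ j, coproj C j z) * _) = _
  rw [Finset.sum_mul, map_sum]
  refine Finset.sum_congr rfl fun j _ => ?_
  rw [coproj_mul_tprod, detForm_tprod, e.det_apply, Module.Basis.toMatrix_update,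
    Module.Basis.toMatrix_self, ← Matrix.cramer_apply, Matrix.cramer_one, Matrix.diag_apply,
    Algebra.leftMulMatrix_eq_repr_mul]
  rfl

/-- With `M` the conjugate matrix, `α(x)² = det (M Mᵀ)`, and the entries of `M Mᵀ` are sums of
conjugates. Applying `symNorm` turns these into traces, and the determinant into the discriminant.
-/
theorem altSq_eq_det (x : Fin n → F) :
    altSq C F x = (Matrix.of fun i k => sumCoproj (C := C) n (x i * x k)).det := by
  refine Subtype.ext ?_
  change _ = (SymTensor C F n).val.toRingHom _
  rw [RingHom.map_det]
  have h : (SymTensor C F n).val.toRingHom.mapMatrix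
      (Matrix.of fun i k => sumCoproj (C := C) n (x i * x k)) =
      (Matrix.of fun i j => coproj C j (x i)) *
        (Matrix.of fun i j => coproj C j (x i)).transpose := by
    ext i k
    rw [Matrix.mul_apply]
    change ∑ j, coproj C j (x i * x k) = _
    exact Finset.sum_congr rfl fun j _ => map_mul _ _ _
  rw [h, Matrix.det_mul, Matrix.det_transpose, ← alternator_tprod, coe_altSq]

theorem symNorm_altSq : symNorm e (altSq C F e) = Algebra.discr C e := by
  rw [altSq_eq_det, RingHom.map_det, Algebra.discr_def]
  congr 1
  ext i k
  exact symNorm_sumCoproj e _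

end Norm

/-! ### Functoriality of tensors and the classifying homomorphism on a chart. -/

section BaseChange

variable {A : Type u} [CommRing A] {R : Type u} [CommRing R] [Algebra A R]
  {C F : Type u} [CommRing C] [CommRing F] [Algebra C F] [Algebra A C] [Algebra A F]
  [IsScalarTower A C F] (n : ℕ) (ρ : R →ₐ[A] F)

/-- The homomorphism `T_A R → T_C F`. -/
def tensorMap : TensorPow A R n →ₐ[A] TensorPow C F n :=
  PiTensorProduct.liftAlgHom
    (((PiTensorProduct.tprod C (s := fun _ : Fin n => F)).restrictScalars A).compLinearMap
      fun _ => ρ.toLinearMap)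
    (by
      change PiTensorProduct.tprod C (fun _ => ρ 1) = _
      simp only [map_one]
      rfl)
    (fun u v => by
      change PiTensorProduct.tprod C (fun i => ρ (u i * v i)) =
        PiTensorProduct.tprod C (fun i => ρ (u i)) * PiTensorProduct.tprod C (fun i => ρ (v i))
      rw [PiTensorProduct.tprod_mul_tprod]
      simp only [map_mul]
      rfl)

variable {n}

theorem tensorMap_tprod (u : Fin n → R) :
    tensorMap (C := C) n ρ (PiTensorProduct.tprod A u) =
      PiTensorProduct.tprod C fun i => ρ (u i) := by
  rw [tensorMap, PiTensorProduct.liftAlgHom_apply]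
  simp

theorem tensorMap_permute (σ : Equiv.Perm (Fin n)) (t : TensorPow A R n) :
    tensorMap (C := C) n ρ (permute A R σ t) = permute C F σ (tensorMap n ρ t) := by
  induction t using PiTensorProduct.induction_on with
  | smul_tprod r u =>
    rw [map_smul, map_smul, map_smul, permute_tprod, tensorMap_tprod, tensorMap_tprod,
      ← algebraMap_smul C r, ← algebraMap_smul C r, map_smul, permute_tprod]
  | add y y' hy hy' => simp only [map_add, hy, hy']

theorem tensorMap_alternator (t : TensorPow A R n) :
    tensorMap (C := C) n ρ (alternator A R n t) = alternator C F n (tensorMap n ρ t) := by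
  simp only [alternator_apply, map_sum, map_smul, tensorMap_permute]
  refine Finset.sum_congr rfl fun σ _ => ?_
  rw [Algebra.smul_def, Algebra.smul_def, map_intCast, map_intCast]

/-- The homomorphism `TS_A R → TS_C F`. -/
def symMap : SymTensor A R n →+* SymTensor C F n :=
  ((tensorMap (C := C) n ρ).toRingHom.comp (SymTensor A R n).val.toRingHom).codRestrict
    (SymTensor C F n) fun a σ hσ => by
      change permute C F σ (tensorMap n ρ a) = tensorMap n ρ a
      rw [← tensorMap_permute, a.2 σ hσ]

theorem coe_symMap (a : SymTensor A R n) :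
    (symMap (C := C) ρ a : TensorPow C F n) = tensorMap n ρ a := rfl

theorem symMap_altMul (y z : TensorPow A R n) :
    symMap (C := C) ρ (altMul A R y z) = altMul C F (tensorMap n ρ y) (tensorMap n ρ z) := by
  refine Subtype.ext ?_
  rw [coe_symMap]
  change tensorMap n ρ (alternator A R n y * alternator A R n z) = _
  rw [map_mul, tensorMap_alternator, tensorMap_alternator]
  rfl

variable (e : Module.Basis (Fin n) C F) {x : Fin n → R}

/-- The homomorphism `𝒜₊(α²(x)) → C` given by an algebra `F` with basis `ρ(x)` whose discriminant
is a non-zero-divisor. -/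
theorem exists_baseChart_hom (he : ∀ i, e i = ρ (x i))
    (hd : Algebra.discr C e ∈ nonZeroDivisors C) :
    ∃ φ : BaseChart A x →+* C,
      (∀ u : Fin n → R, φ (ratio A x (PiTensorProduct.tprod A u)) = e.det fun i => ρ (u i)) ∧
      ∀ a : A, φ (Chart.ofBase (algebraMap A (SymTensor A R n) a)) = algebraMap A C a := by
  have hx : tensorMap (C := C) n ρ (PiTensorProduct.tprod A x) = PiTensorProduct.tprod C e := by
    rw [tensorMap_tprod]
    congr 1
    exact (funext he).symm
  let ψ : SymTensor A R n →+* C := (symNorm e).comp (symMap ρ)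
  have hψ (y z : TensorPow A R n) : ψ (altMul A R y z) =
      detForm e (tensorMap n ρ y) * detForm e (tensorMap n ρ z) * Algebra.discr C e := by
    change symNorm e (symMap ρ _) = _
    rw [symMap_altMul, symNorm_altMul, symNorm_altSq]
  have hψx : ψ (altSq A R x) = Algebra.discr C e := by
    rw [altSq, hψ, hx, detForm_tprod_self, one_mul, one_mul]
  -- By `hψ` the generators `α(y) α(z)` go to multiples of the discriminant, a non-zero-divisor by
  -- hypothesis.
  obtain ⟨φ, hφ⟩ := Chart.exists_hom_of_map_le (I := canonicalIdeal A R n)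
    (h₀ := altSq_mem A R n x) ψ (hψx.symm ▸ hd) (by
      rw [canonicalIdeal, Ideal.map_span, Ideal.span_le]
      rintro _ ⟨_, ⟨⟨y, z⟩, rfl⟩, rfl⟩
      rw [hψx]
      exact Ideal.mem_span_singleton'.mpr ⟨_, (hψ y z).symm⟩)
  refine ⟨φ, fun u => ?_, fun a => ?_⟩
  · have h := hφ 1 _ ((pow_one (canonicalIdeal A R n)).symm ▸
      altMul_mem (PiTensorProduct.tprod A u) (PiTensorProduct.tprod A x))
    rw [pow_one (ψ _), hψx, hψ, hx, detForm_tprod_self, mul_one, tensorMap_tprod, detForm_tprod] at h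
    exact (mul_cancel_right_mem_nonZeroDivisors hd).mp h
  · have h := hφ 0 (algebraMap A (SymTensor A R n) a) (by simp)
    rw [← Chart.ofBase_eq_frac, pow_zero, mul_one] at h
    rw [h]
    change symNorm e (symMap ρ _) = _
    rw [symNorm_apply, coe_symMap]
    change detForm e (tensorMap n ρ (algebraMap A _ a) * _) = _
    rw [AlgHom.commutes, ← Algebra.smul_def, ← algebraMap_smul C a, map_smul, detForm_tprod_self,
      smul_eq_mul, mul_one]

end BaseChange

/-! ### Base change of free algebras -/

section FreeBaseChange

variable {A' R' C F : Type u} [CommRing A'] [CommRing R'] [CommRing C] [CommRing F]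
  [Algebra A' R'] [Algebra C F] {n : ℕ}

/-- The linear map carrying basis to basis is multiplicative because the structure constants
correspond, and the induced map from the base change is an isomorphism because it carries a basis to
a basis. -/
theorem exists_hom_isPushout_of_basis (b : Module.Basis (Fin n) A' R') (φ : A' →+* C)
    (e : Module.Basis (Fin n) C F)
    (hone : ∑ i, φ (b.repr 1 i) • e i = 1)
    (hmul : ∀ i j, ∑ k, φ (b.repr (b i * b j) k) • e k = e i * e j) :
    ∃ χ : R' →+* F, (∀ z, χ z = ∑ i, φ (b.repr z i) • e i) ∧
      IsPushout (CommRingCat.ofHom φ) (CommRingCat.ofHom (algebraMap A' R'))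
        (CommRingCat.ofHom (algebraMap C F)) (CommRingCat.ofHom χ) := by
  let : Algebra A' C := φ.toAlgebra
  let : Algebra A' F := ((algebraMap C F).comp φ).toAlgebra
  have : IsScalarTower A' C F := IsScalarTower.of_algebraMap_eq fun _ => rfl
  let f : R' →ₗ[A'] F := b.constr A' e
  have hf (z : R') : f z = ∑ i, φ (b.repr z i) • e i := by
    rw [Module.Basis.constr_apply_fintype]
    refine Finset.sum_congr rfl fun i _ => ?_
    rw [Module.Basis.equivFun_apply, ← algebraMap_smul C]
    rfl
  have hfb (i : Fin n) : f (b i) = e i := Module.Basis.constr_basis ..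
  have hfm : ∀ z w, f (z * w) = f z * f w := by
    rw [LinearMap.map_mul_iff]
    refine b.ext fun i => b.ext fun j => ?_
    change f (b i * b j) = f (b i) * f (b j)
    rw [hfb, hfb, ← hmul, hf]
  let χ : R' →ₐ[A'] F := AlgHom.ofLinearMap f (by rw [hf, hone]) hfm
  refine ⟨χ.toRingHom, hf, ?_⟩
  let : Algebra R' F := χ.toRingHom.toAlgebra
  have : IsScalarTower A' R' F := IsScalarTower.of_algebraMap_eq fun z => (χ.commutes z).symm
  refine CommRingCat.isPushout_iff_isPushout.mpr ⟨IsBaseChange.of_equiv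
    ((b.baseChange C).equiv e (Equiv.refl _)) fun z => ?_⟩
  have : ((((b.baseChange C).equiv e (Equiv.refl _)).toLinearMap.restrictScalars A').comp
      (TensorProduct.mk A' C R' 1)) = f := by
    refine b.ext fun i => ?_
    rw [hfb]
    change (b.baseChange C).equiv e (Equiv.refl _) (1 ⊗ₜ b i) = _
    rw [← Module.Basis.baseChange_apply, Module.Basis.equiv_apply]
    rfl
  exact LinearMap.congr_fun this z

theorem exists_basis_of_isPushout (b : Module.Basis (Fin n) A' R') (φ : A' →+* C) (χ : R' →+* F)
    (h : IsPushout (CommRingCat.ofHom φ) (CommRingCat.ofHom (algebraMap A' R'))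
      (CommRingCat.ofHom (algebraMap C F)) (CommRingCat.ofHom χ)) :
    ∃ e : Module.Basis (Fin n) C F, (∀ i, e i = χ (b i)) ∧
      ∀ z i, e.repr (χ z) i = φ (b.repr z i) := by
  let : Algebra A' C := φ.toAlgebra
  let : Algebra A' F := ((algebraMap C F).comp φ).toAlgebra
  have : IsScalarTower A' C F := IsScalarTower.of_algebraMap_eq fun _ => rfl
  let : Algebra R' F := χ.toAlgebra
  have : IsScalarTower A' R' F := IsScalarTower.of_algebraMap_eq fun z => by
    have := congrArg (fun g => g.hom z) h.w
    exact this
  have h' : Algebra.IsPushout A' C R' F := CommRingCat.isPushout_iff_isPushout.mp h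
  exact ⟨h'.out.basis b, fun i => h'.out.basis_apply b i, fun z i =>
    h'.out.basis_repr_comp_apply b z i⟩

end FreeBaseChange

/-! ### Homomorphisms from a chart and free algebras -/

section ChartHoms

variable {A : Type u} [CommRing A] {R : Type u} [CommRing R] [Algebra A R] {n : ℕ} [NeZero n]

instance (x : Fin n → R) : Algebra (BaseChart A x) (FamilyChart A x) := (chartHom A x).toAlgebra

theorem algebraMap_chart (x : Fin n → R) :
    algebraMap (BaseChart A x) (FamilyChart A x) = chartHom A x := rfl

variable (A) in
/-- The images of `x₁, …, xₙ` form a basis of `ℛ₊(α²(x))` over `𝒜₊(α²(x))`. -/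
def chartBasis (x : Fin n → R) : Module.Basis (Fin n) (BaseChart A x) (FamilyChart A x) :=
  Module.Basis.mk (v := fun i => chartCoproj A x (x i))
    (Fintype.linearIndependent_iff.mpr fun c hc => eq_zero_of_sum_chartCoproj A x c hc)
    (fun z _ => by
      obtain ⟨c, rfl⟩ := exists_sum_chartCoproj A x z
      exact Submodule.sum_mem _ fun i _ => Submodule.smul_mem _ (c i)
        (Submodule.subset_span ⟨i, rfl⟩))

theorem chartBasis_apply (x : Fin n → R) (i : Fin n) :
    chartBasis A x i = chartCoproj A x (x i) := by
  rw [chartBasis, Module.Basis.mk_apply]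

theorem chartBasis_repr_chartCoproj (x : Fin n → R) (z : R) (i : Fin n) :
    (chartBasis A x).repr (chartCoproj A x z) i =
      ratio A x (PiTensorProduct.tprod A (Function.update x i z)) := by
  have h : chartCoproj A x z = ∑ i, ratio A x (PiTensorProduct.tprod A (Function.update x i z)) •
      chartBasis A x i := by
    simp only [Algebra.smul_def, algebraMap_chart, chartBasis_apply]
    exact chartCoproj_eq_sum A x z
  rw [h, Module.Basis.repr_sum_self]

variable {C F : Type u} [CommRing C] [CommRing F] [Algebra C F] {x : Fin n → R}

/-- The `i`-th coordinate of `z` over the chart goes under `φ` to the determinant of `e` with `e i`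
replaced by `ρ z`, which is the `i`-th coordinate of `ρ z`. Taking `z = 1` and `z = x i * x j`
matches units and structure constants. -/
theorem exists_familyChart_hom (ρ : R →+* F) (φ : BaseChart A x →+* C)
    (e : Module.Basis (Fin n) C F) (he : ∀ i, e i = ρ (x i))
    (hφ : ∀ u : Fin n → R, φ (ratio A x (PiTensorProduct.tprod A u)) = e.det fun i => ρ (u i)) :
    ∃ χ : FamilyChart A x →+* F, χ.comp (chartCoproj A x) = ρ ∧
      IsPushout (CommRingCat.ofHom φ) (CommRingCat.ofHom (chartHom A x))
        (CommRingCat.ofHom (algebraMap C F)) (CommRingCat.ofHom χ) := by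
  have key (z : R) : ∑ i, φ ((chartBasis A x).repr (chartCoproj A x z) i) • e i = ρ z := by
    conv_rhs => rw [← e.sum_repr (ρ z)]
    refine Finset.sum_congr rfl fun i _ => ?_
    have h : (fun k => ρ (Function.update x i z k)) = Function.update e i (ρ z) := by
      funext k
      rcases eq_or_ne k i with rfl | hk
      · simp
      · simp [hk, he]
    rw [chartBasis_repr_chartCoproj, hφ, h, e.det_apply, Module.Basis.toMatrix_update,
      Module.Basis.toMatrix_self, ← Matrix.cramer_apply, Matrix.cramer_one]
    rfl
  obtain ⟨χ, hχ, hpush⟩ := exists_hom_isPushout_of_basis (chartBasis A x) φ e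
    (by rw [← map_one (chartCoproj A x), key, map_one]) (fun i j => by
      rw [chartBasis_apply, chartBasis_apply, ← map_mul, key, map_mul, he, he])
  exact ⟨χ, RingHom.ext fun z => by rw [RingHom.comp_apply, hχ, key], hpush⟩

/-- Base change sends the coordinates of each `u i` to those of `ρ (u i)`, and by `det_ratio` the
ratio of `u` is the determinant of these coordinates. -/
theorem exists_basis_of_isPushout_chart (ρ : R →+* F) (φ : BaseChart A x →+* C)
    (χ : FamilyChart A x →+* F) (hχ : χ.comp (chartCoproj A x) = ρ)
    (h : IsPushout (CommRingCat.ofHom φ) (CommRingCat.ofHom (chartHom A x))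
      (CommRingCat.ofHom (algebraMap C F)) (CommRingCat.ofHom χ)) :
    ∃ e : Module.Basis (Fin n) C F, (∀ i, e i = ρ (x i)) ∧
      ∀ u : Fin n → R, φ (ratio A x (PiTensorProduct.tprod A u)) = e.det fun i => ρ (u i) := by
  obtain ⟨e, he, he'⟩ := exists_basis_of_isPushout (chartBasis A x) φ χ h
  have hχ' (z : R) : ρ z = χ (chartCoproj A x z) := by rw [← hχ]; rfl
  refine ⟨e, fun i => by rw [he, chartBasis_apply, hχ'], fun u => ?_⟩
  rw [← det_ratio, RingHom.map_det, e.det_apply, ← Matrix.det_transpose]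
  congr 1
  ext k i
  change φ _ = e.repr (ρ (u i)) k
  rw [hχ', he', chartBasis_repr_chartCoproj]
  rfl

theorem baseChart_hom_ext {φ φ' : BaseChart A x →+* C}
    (h : ∀ u : Fin n → R, φ (ratio A x (PiTensorProduct.tprod A u)) =
      φ' (ratio A x (PiTensorProduct.tprod A u))) : φ = φ' := by
  refine RingHom.eq_of_eqOn_set_dense (closure_ratio_tprod A x) ?_
  rintro _ ⟨u, rfl⟩
  exact h u

/-- A homomorphism from a chart is determined by the base change of the family. -/
theorem eq_of_isPushout_chart (ρ : R →+* F) {φ φ' : BaseChart A x →+* C}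
    {χ χ' : FamilyChart A x →+* F} (hχ : χ.comp (chartCoproj A x) = ρ)
    (hχ' : χ'.comp (chartCoproj A x) = ρ)
    (h : IsPushout (CommRingCat.ofHom φ) (CommRingCat.ofHom (chartHom A x))
      (CommRingCat.ofHom (algebraMap C F)) (CommRingCat.ofHom χ))
    (h' : IsPushout (CommRingCat.ofHom φ') (CommRingCat.ofHom (chartHom A x))
      (CommRingCat.ofHom (algebraMap C F)) (CommRingCat.ofHom χ')) : φ = φ' := by
  obtain ⟨e, he, hφ⟩ := exists_basis_of_isPushout_chart ρ φ χ hχ h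
  obtain ⟨e', he', hφ'⟩ := exists_basis_of_isPushout_chart ρ φ' χ' hχ' h'
  have : e = e' := Module.Basis.eq_of_apply_eq fun i => by rw [he, he']
  subst this
  exact baseChart_hom_ext fun u => by rw [hφ, hφ']

variable (A x) in
/-- The fraction `α²(y) / α²(x)`. -/
def chartFrac (y : Fin n → R) : BaseChart A x :=
  Chart.frac 1 (altSq A R y) (by rw [pow_one]; exact altSq_mem A R n y)

/-- Two tuples whose images are bases have associated discriminants. -/
theorem isUnit_chartFrac_of_isPushout (ρ : R →+* F) {y : Fin n → R}
    (φ : BaseChart A x →+* C) (χ : FamilyChart A x →+* F) (hχ : χ.comp (chartCoproj A x) = ρ)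
    (h : IsPushout (CommRingCat.ofHom φ) (CommRingCat.ofHom (chartHom A x))
      (CommRingCat.ofHom (algebraMap C F)) (CommRingCat.ofHom χ))
    (e' : Module.Basis (Fin n) C F) (he' : ∀ i, e' i = ρ (y i)) :
    IsUnit (φ (chartFrac A x y)) := by
  obtain ⟨e, he, hφ⟩ := exists_basis_of_isPushout_chart ρ φ χ hχ h
  have h1 : chartFrac A x y = ratio A x (PiTensorProduct.tprod A y) *
      ratio A x (PiTensorProduct.tprod A y) := (ratio_mul_ratio A x _ _).symm
  have h2 : (fun i => ρ (y i)) = e' := funext fun i => (he' i).symm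
  rw [h1, map_mul, hφ, h2]
  exact (e.isUnit_det e').mul (e.isUnit_det e')

end ChartHoms

/-! ### Charts as open subschemes of the blow-up -/

section ChartImmersion

variable {S : Type u} [CommRing S] (I : Ideal S)

/-- The blow-up algebra is generated in degree one: an element of degree `k + 1` is a sum of
products of an element of degree `k` and a generator. -/
theorem irrelevant_le_of_span {G : Set S} (hG : Ideal.span G = I) (J : Ideal (reesAlgebra I))
    (h : ∀ a (ha : a ∈ G), degOne I a (hG ▸ Ideal.subset_span ha) ∈ J) :
    (HomogeneousIdeal.irrelevant (reesGrading I)).toIdeal ≤ J := by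
  refine (HomogeneousIdeal.toIdeal_irrelevant_le _).mpr fun i hi f hf => ?_
  obtain ⟨a, ha, rfl⟩ := mem_reesGrading_iff.mp hf
  obtain ⟨k, rfl⟩ := Nat.exists_eq_succ_of_ne_zero hi.ne'
  let N : Submodule S (Polynomial S) :=
    (J.restrictScalars S).map (reesAlgebra I).val.toLinearMap
  have key : I ^ (k + 1) ≤ N.comap (Polynomial.monomial (k + 1)) := by
    rw [pow_succ, Ideal.mul_le]
    intro r hr s hs
    suffices I ≤ (N.comap (Polynomial.monomial (k + 1))).comap (LinearMap.mulLeft S r) from this hs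
    conv_lhs => rw [← hG]
    refine Ideal.span_le.mpr fun g hg => ?_
    refine ⟨reesMonomial k r hr * degOne I g (hG ▸ Ideal.subset_span hg),
      J.mul_mem_left _ (h g hg), ?_⟩
    exact Polynomial.monomial_mul_monomial ..
  obtain ⟨y, hy, hya⟩ := key ha
  have : y = reesMonomial (k + 1) a ha := Subtype.ext hya
  exact this ▸ hy

/-- The open immersion of a chart in the blow-up. -/
def Chart.ι (d : S) (hd : d ∈ I) : Spec (.of (Chart I d hd)) ⟶ Proj (reesGrading I) :=
  Proj.awayι (reesGrading I) (degOne I d hd) (degOne_mem I d hd) one_pos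

instance (d : S) (hd : d ∈ I) : IsOpenImmersion (Chart.ι I d hd) :=
  inferInstanceAs (IsOpenImmersion (Proj.awayι _ _ _ _))

theorem Chart.opensRange_ι (d : S) (hd : d ∈ I) :
    (Chart.ι I d hd).opensRange = Proj.basicOpen (reesGrading I) (degOne I d hd) :=
  Proj.opensRange_awayι ..

theorem Chart.ι_toSpecZero (d : S) (hd : d ∈ I) :
    Chart.ι I d hd ≫ Proj.toSpecZero (reesGrading I) ≫
        Spec.map (CommRingCat.ofHom (algebraMap S (reesGrading I 0))) =
      Spec.map (CommRingCat.ofHom Chart.ofBase) := by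
  refine (Proj.awayι_toSpecZero_assoc (reesGrading I) (degOne I d hd) (degOne_mem I d hd) one_pos
    _).trans ?_
  exact (Spec.map_comp _ _).symm

theorem Chart.ι_preimage_basicOpen (d d' : S) (hd : d ∈ I) (hd' : d' ∈ I) :
    Chart.ι I d hd ⁻¹ᵁ Proj.basicOpen (reesGrading I) (degOne I d' hd') =
      PrimeSpectrum.basicOpen
        (Chart.frac 1 d' (by rwa [pow_one]) : Chart I d hd) := by
  refine (Proj.awayι_preimage_basicOpen (reesGrading I) (degOne_mem I d hd) one_pos
    (degOne_mem I d' hd') one_pos).trans ?_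
  congr 1
  apply Chart.val_injective
  rw [Chart.val_frac]
  change Localization.mk _ _ = _
  congr 1
  exact pow_one _

variable {S' : Type u} [CommRing S'] (φ : S →+* S')

theorem Chart.ι_map (d : S) (hd : d ∈ I) :
    Chart.ι (I.map φ) (φ d) (Ideal.mem_map_of_mem φ hd) ≫
        Proj.map (reesMap I φ) (irrelevant_le_map_reesMap I φ) =
      Spec.map (CommRingCat.ofHom (Chart.map I d hd φ)) ≫ Chart.ι I d hd := by
  -- The image of `degOne I d hd` occurs in types, so it is replaced by a variable `t` before the
  -- equality is substituted.
  have aux (t : reesAlgebra (I.map φ)) (ht : reesMap I φ (degOne I d hd) = t)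
      (ht1 : t ∈ reesGrading (I.map φ) 1)
      (hle : Submonoid.powers (degOne I d hd) ≤ (Submonoid.powers t).comap (reesMap I φ)) :
      Proj.awayι (reesGrading (I.map φ)) t ht1 one_pos ≫
          Proj.map (reesMap I φ) (irrelevant_le_map_reesMap I φ) =
        Spec.map (CommRingCat.ofHom (HomogeneousLocalization.map (reesMap I φ) hle)) ≫
          Proj.awayι (reesGrading I) (degOne I d hd) (degOne_mem I d hd) one_pos := by
    subst ht
    exact Proj.awayι_comp_map (reesMap I φ) (irrelevant_le_map_reesMap I φ) one_pos _ _
  exact aux _ (reesMap_degOne I φ d hd) _ _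

end ChartImmersion

/-! ### The universal family and its affine charts. -/

section Universal

theorem opensRange_of_comp_ι {X Y : Scheme.{u}} (U : Y.Opens) (i : X ⟶ U.toScheme) (j : X ⟶ Y)
    [IsOpenImmersion i] [IsOpenImmersion j] (h : i ≫ U.ι = j) :
    i.opensRange = U.ι ⁻¹ᵁ j.opensRange := by
  subst h
  rw [Scheme.Hom.opensRange_comp, Scheme.Hom.preimage_image_eq]

variable {A : Type u} [CommRing A] {R : Type u} [CommRing R] [Algebra A R] {n : ℕ}

variable (A R n) in
theorem span_altMul_tprod : Ideal.span (Set.range fun p : (Fin n → R) × (Fin n → R) =>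
    altMul A R (PiTensorProduct.tprod A p.1) (PiTensorProduct.tprod A p.2)) =
      canonicalIdeal A R n := by
  refine le_antisymm (Ideal.span_le.mpr ?_) (Ideal.span_le.mpr ?_)
  · rintro _ ⟨p, rfl⟩
    exact altMul_mem _ _
  · have hsmul (r : A) (y z : TensorPow A R n) :
        altMul A R (r • y) z = algebraMap A _ r * altMul A R y z := by
      rw [← altMul_mul, Algebra.smul_def]
      rfl
    rintro _ ⟨⟨y, z⟩, rfl⟩
    change altMul A R y z ∈ Ideal.span _
    induction y using PiTensorProduct.induction_on with
    | add y y' hy hy' => rw [altMul_add]; exact Ideal.add_mem _ hy hy'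
    | smul_tprod r u =>
      rw [hsmul]
      refine Ideal.mul_mem_left _ _ ?_
      induction z using PiTensorProduct.induction_on with
      | add z z' hz hz' =>
        rw [altMul_comm, altMul_add, altMul_comm z, altMul_comm z']
        exact Ideal.add_mem _ hz hz'
      | smul_tprod r v =>
        rw [altMul_comm, hsmul, altMul_comm]
        exact Ideal.mul_mem_left _ _ (Ideal.subset_span ⟨(u, v), rfl⟩)

variable (A R n) in
-- The products `α(u) α(v)` of pure tensors generate the canonical ideal, so their basic opens cover
-- `Proj`. The square of such a product is `α²(u) α²(v)`, so its basic open lies in that of `α²(u)`.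
theorem uPlus_eq_top : uPlus A R n = ⊤ := by
  let g (p : (Fin n → R) × (Fin n → R)) : SymTensor A R n :=
    altMul A R (PiTensorProduct.tprod A p.1) (PiTensorProduct.tprod A p.2)
  have hg (p) : g p ∈ canonicalIdeal A R n := altMul_mem _ _
  rw [eq_top_iff, ← Proj.iSup_basicOpen_eq_top (reesGrading (canonicalIdeal A R n))
    (fun p => degOne _ (g p) (hg p)) (irrelevant_le_of_span _ (span_altMul_tprod A R n) _ (by
      rintro _ ⟨p, rfl⟩
      exact Ideal.subset_span ⟨p, rfl⟩))]
  refine iSup_le fun p => ?_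
  have h : degOne _ (g p) (hg p) ^ 2 = degOne _ (altSq A R p.1) (altSq_mem A R n p.1) *
      degOne _ (altSq A R p.2) (altSq_mem A R n p.2) := by
    refine Subtype.ext ?_
    rw [pow_two]
    change Polynomial.monomial 1 _ * Polynomial.monomial 1 _ =
      Polynomial.monomial 1 _ * Polynomial.monomial 1 _
    rw [Polynomial.monomial_mul_monomial, Polynomial.monomial_mul_monomial]
    congr 1
    exact altMul_mul_altMul ..
  rw [← Proj.basicOpen_pow _ _ 2 two_pos, h, Proj.basicOpen_mul]
  exact inf_le_left.trans (le_iSup (fun x : Fin n → R =>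
    Proj.basicOpen (reesGrading (canonicalIdeal A R n))
      (degOne _ (altSq A R x) (altSq_mem A R n x))) p.1)

variable (A) in
theorem range_ι_le_uPlus (x : Fin n → R) :
    (Chart.ι (canonicalIdeal A R n) (altSq A R x) (altSq_mem A R n x)).opensRange ≤
      uPlus A R n := by
  rw [Chart.opensRange_ι]
  exact le_iSup (fun x : Fin n → R => Proj.basicOpen (reesGrading (canonicalIdeal A R n))
    (degOne _ (altSq A R x) (altSq_mem A R n x))) x

variable (A) in
/-- The open immersion `Spec 𝒜₊(α²(x)) → 𝒰⁺_R`. -/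
def baseι (x : Fin n → R) : Spec (.of (BaseChart A x)) ⟶ (uPlus A R n).toScheme :=
  IsOpenImmersion.lift (uPlus A R n).ι
    (Chart.ι (canonicalIdeal A R n) (altSq A R x) (altSq_mem A R n x)) (by
      rw [Scheme.Opens.range_ι]; exact range_ι_le_uPlus A x)

theorem baseι_ι (x : Fin n → R) : baseι A x ≫ (uPlus A R n).ι =
    Chart.ι (canonicalIdeal A R n) (altSq A R x) (altSq_mem A R n x) :=
  IsOpenImmersion.lift_fac ..

instance (x : Fin n → R) : IsOpenImmersion (baseι A x) :=
  have : IsOpenImmersion (baseι A x ≫ (uPlus A R n).ι) := by rw [baseι_ι]; infer_instance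
  IsOpenImmersion.of_comp _ (uPlus A R n).ι

theorem opensRange_baseι (x : Fin n → R) : (baseι A x).opensRange = (uPlus A R n).ι ⁻¹ᵁ
    Proj.basicOpen (reesGrading (canonicalIdeal A R n))
      (degOne _ (altSq A R x) (altSq_mem A R n x)) := by
  rw [← Chart.opensRange_ι, opensRange_of_comp_ι _ _ _ (baseι_ι x)]

theorem exists_mem_opensRange_baseι (w : (uPlus A R n).toScheme) :
    ∃ x : Fin n → R, w ∈ (baseι A x).opensRange := by
  obtain ⟨x, hx⟩ := TopologicalSpace.Opens.mem_iSup.mp w.2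
  exact ⟨x, by rw [opensRange_baseι]; exact hx⟩

theorem baseι_preimage (x y : Fin n → R) : baseι A x ⁻¹ᵁ (baseι A y).opensRange =
    PrimeSpectrum.basicOpen (chartFrac A x y) := by
  rw [opensRange_baseι, ← Scheme.Hom.comp_preimage, baseι_ι, Chart.ι_preimage_basicOpen]
  rfl

theorem baseι_uPlusToBase (x : Fin n → R) : baseι A x ≫ uPlusToBase A R n =
    Spec.map (CommRingCat.ofHom (Chart.ofBase.comp (algebraMap A (SymTensor A R n)))) := by
  rw [uPlusToBase, ← Category.assoc, baseι_ι, CommRingCat.ofHom_comp, Spec.map_comp,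
    CommRingCat.ofHom_comp, Spec.map_comp, ← Chart.ι_toSpecZero]
  simp only [Category.assoc]

variable [NeZero n]

variable (A) in
theorem basicOpen_eq_preimage (x : Fin n → R) :
    Proj.basicOpen (reesGrading (canonicalIdeal' A R n))
      (degOne _ (symInclusion A R n (altSq A R x)) (symInclusion_altSq_mem A R n x)) =
      blowUpMap A R n ⁻¹ᵁ Proj.basicOpen (reesGrading (canonicalIdeal A R n))
        (degOne _ (altSq A R x) (altSq_mem A R n x)) := by
  rw [blowUpMap, Proj.map_preimage_basicOpen, reesMap_degOne]
  rfl

variable (A) in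
/-- The open immersion `Spec ℛ₊(α²(x)) → 𝒵⁺_R`. -/
def familyι (x : Fin n → R) : Spec (.of (FamilyChart A x)) ⟶ (zPlus A R n).toScheme :=
  IsOpenImmersion.lift (zPlus A R n).ι (Chart.ι (canonicalIdeal' A R n)
    (symInclusion A R n (altSq A R x)) (symInclusion_altSq_mem A R n x)) (by
      have : (Chart.ι (canonicalIdeal' A R n) (symInclusion A R n (altSq A R x))
          (symInclusion_altSq_mem A R n x)).opensRange ≤ zPlus A R n := by
        rw [Chart.opensRange_ι]
        exact le_iSup (fun x : Fin n → R => Proj.basicOpen (reesGrading (canonicalIdeal' A R n))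
          (degOne _ (symInclusion A R n (altSq A R x)) (symInclusion_altSq_mem A R n x))) x
      rw [Scheme.Opens.range_ι]; exact this)

theorem familyι_ι (x : Fin n → R) : familyι A x ≫ (zPlus A R n).ι =
    Chart.ι (canonicalIdeal' A R n) (symInclusion A R n (altSq A R x))
      (symInclusion_altSq_mem A R n x) :=
  IsOpenImmersion.lift_fac ..

instance (x : Fin n → R) : IsOpenImmersion (familyι A x) :=
  have : IsOpenImmersion (familyι A x ≫ (zPlus A R n).ι) := by rw [familyι_ι]; infer_instance
  IsOpenImmersion.of_comp _ (zPlus A R n).ι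

theorem zPlusToUPlus_ι : zPlusToUPlus A R n ≫ (uPlus A R n).ι =
    (zPlus A R n).ι ≫ blowUpMap A R n :=
  Scheme.Hom.resLE_comp_ι ..

theorem isPullback_familyι (x : Fin n → R) :
    IsPullback (familyι A x) (Spec.map (CommRingCat.ofHom (chartHom A x)))
      (zPlusToUPlus A R n) (baseι A x) := by
  refine (IsOpenImmersion.isPullback _ _ _ _ ?_ ?_).flip
  · rw [← cancel_mono (uPlus A R n).ι, Category.assoc, Category.assoc, zPlusToUPlus_ι, baseι_ι,
      ← Category.assoc, familyι_ι]
    exact Chart.ι_map _ _ _ _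
  · rw [opensRange_baseι, ← Scheme.Hom.comp_preimage, zPlusToUPlus_ι, Scheme.Hom.comp_preimage,
      ← basicOpen_eq_preimage, ← Chart.opensRange_ι, opensRange_of_comp_ι _ _ _ (familyι_ι x)]

theorem familyι_zPlusToSpec (x : Fin n → R) : familyι A x ≫ zPlusToSpec A R n =
    Spec.map (CommRingCat.ofHom (chartCoproj A x)) := by
  rw [zPlusToSpec, ← Category.assoc, familyι_ι, chartCoproj, CommRingCat.ofHom_comp,
    Spec.map_comp, CommRingCat.ofHom_comp, Spec.map_comp, ← Chart.ι_toSpecZero]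
  simp only [Category.assoc]

end Universal

/-! ### Gluing morphisms that classify families -/

section Gluing

theorem hom_ext_of_affine {X Y : Scheme.{u}} (f g : X ⟶ Y)
    (H : ∀ w : X, ∃ O : X.Opens, w ∈ O ∧ ∀ (C : CommRingCat.{u}) (j : Spec C ⟶ X),
      IsOpenImmersion j → Set.range j ⊆ O → j ≫ f = j ≫ g) : f = g := by
  choose O hO hfg using H
  choose C j hj hwj hjO using fun w => Scheme.exists_affine_mem_range_and_range_subset (hO w)
  exact Scheme.Cover.hom_ext (Scheme.Cover.mkOfCovers X (fun w => Spec (C w)) j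
    (fun w => ⟨w, hwj w⟩) hj) f g fun w => hfg w (C w) (j w) (hj w) (hjO w)

variable {Z U Y : Scheme.{u}} (p : Z ⟶ U) (r : Z ⟶ Y)

/-- The family `π : X ⟶ W`, together with `ρ : X ⟶ Y`, is the pull-back of the family `p : Z ⟶ U`,
together with `r : Z ⟶ Y`, along `f`. -/
def Classifies {X W : Scheme.{u}} (π : X ⟶ W) (ρ : X ⟶ Y) (f : W ⟶ U) : Prop :=
  ∃ g : X ⟶ Z, IsPullback g π p f ∧ g ≫ r = ρ

variable {p r}

theorem Classifies.of_isPullback {X W X' W' : Scheme.{u}} {π : X ⟶ W} {ρ : X ⟶ Y} {f : W ⟶ U}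
    (h : Classifies p r π ρ f) {a : X' ⟶ X} {π' : X' ⟶ W'} {j : W' ⟶ W}
    (hj : IsPullback a π' π j) : Classifies p r π' (a ≫ ρ) (j ≫ f) := by
  obtain ⟨g, hg, rfl⟩ := h
  exact ⟨a ≫ g, hj.paste_horiz hg, Category.assoc ..⟩

/-- A family that is classified locally is classified globally, provided that classifying morphisms
are unique and that points of `Z` are determined by their images under `p` and `r`. -/
theorem exists_classifies_of_local
    (hmono : ∀ {X : Scheme.{u}} (g g' : X ⟶ Z), g ≫ p = g' ≫ p → g ≫ r = g' ≫ r → g = g')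
    (huniq : ∀ {X W : Scheme.{u}} {π : X ⟶ W} {ρ : X ⟶ Y} {f f' : W ⟶ U},
      Classifies p r π ρ f → Classifies p r π ρ f' → f = f')
    {S : Scheme.{u}} (s : U ⟶ S) {X W : Scheme.{u}} (π : X ⟶ W) (ρ : X ⟶ Y) (t : W ⟶ S)
    (hloc : ∀ w : W, ∃ (V X' : Scheme.{u}) (j : V ⟶ W) (a : X' ⟶ X) (π' : X' ⟶ V) (f : V ⟶ U),
      IsOpenImmersion j ∧ w ∈ Set.range j ∧ IsPullback a π' π j ∧ Classifies p r π' (a ≫ ρ) f ∧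
        f ≫ s = j ≫ t) :
    ∃ f : W ⟶ U, Classifies p r π ρ f ∧ f ≫ s = t := by
  choose V X' j a π' f hj hw ha hf hfs using hloc
  let 𝒰 : W.OpenCover := Scheme.Cover.mkOfCovers W V j (fun w => ⟨w, hw w⟩) hj
  -- Pull-backs are unique up to isomorphism, so the given local family may be replaced by the
  -- chosen fibre product.
  have hf' (w : W) : Classifies p r (pullback.snd π (j w)) (pullback.fst π (j w) ≫ ρ) (f w) := by
    have := (hf w).of_isPullback (IsPullback.of_horiz_isIso (fst := (ha w).isoPullback.inv)
      (snd := pullback.snd π (j w)) (f := π' w) (g := 𝟙 _) ⟨by simp⟩)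
    simpa using this
  have hcompat (w w' : W) : pullback.fst (j w) (j w') ≫ f w = pullback.snd (j w) (j w') ≫ f w' := by
    obtain ⟨k, hk, hk'⟩ : ∃ k, pullback.fst (j w) (j w') ≫ j w = k ∧
        pullback.snd (j w) (j w') ≫ j w' = k := ⟨_, rfl, pullback.condition.symm⟩
    -- Both restrictions to the overlap classify the same family, so `huniq` identifies them.
    have key (v : W) (b : pullback (j w) (j w') ⟶ V v) (hb : b ≫ j v = k) :
        Classifies p r (pullback.snd π k) (pullback.fst π k ≫ ρ) (b ≫ f v) := by
      have e : pullback.fst π k ≫ π = (pullback.snd π k ≫ b) ≫ j v := by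
        rw [Category.assoc, hb, pullback.condition]
      have h : IsPullback (pullback.lift _ _ e) (pullback.snd π k) (pullback.snd π (j v)) b :=
        IsPullback.of_right (by
          rw [pullback.lift_fst, hb]
          exact IsPullback.of_hasPullback π k) (pullback.lift_snd _ _ _)
          (IsPullback.of_hasPullback π (j v))
      have := (hf' v).of_isPullback h
      rwa [← Category.assoc, pullback.lift_fst] at this
    exact huniq (key w _ hk) (key w' _ hk')
  let F : W ⟶ U := 𝒰.glueMorphisms f hcompat
  have hF (w : W) : j w ≫ F = f w := 𝒰.ι_glueMorphisms f hcompat w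
  choose g hg hgr using hf'
  -- The maps to `Z` agree on overlaps because both composites with `p` and `r` come from maps on
  -- all of `X`.
  have hgcompat (w w' : W) : pullback.fst (pullback.fst π (j w)) (pullback.fst π (j w')) ≫ g w =
      pullback.snd (pullback.fst π (j w)) (pullback.fst π (j w')) ≫ g w' := by
    refine hmono _ _ ?_ ?_
    · have h (w) : g w ≫ p = pullback.fst π (j w) ≫ π ≫ F := by
        rw [(hg w).w, ← hF, pullback.condition_assoc]
      rw [Category.assoc, Category.assoc, h, h, pullback.condition_assoc]
    · rw [Category.assoc, Category.assoc, hgr, hgr, pullback.condition_assoc]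
  let G : X ⟶ Z := Scheme.Cover.glueMorphisms (𝒰.pullback₁ π) g hgcompat
  have hG (w : W) : pullback.fst π (j w) ≫ G = g w :=
    Scheme.Cover.ι_glueMorphisms (𝒰.pullback₁ π) g hgcompat w
  refine ⟨F, ⟨G, (Scheme.isPullback_of_openCover π G F p 𝒰 fun (w : W) => ?_).flip, ?_⟩, ?_⟩
  · change IsPullback (pullback.snd π (j w)) (pullback.fst π (j w) ≫ G) (j w ≫ F) p
    simpa only [hG, hF] using (hg w).flip
  · refine Scheme.Cover.hom_ext (𝒰.pullback₁ π) _ _ fun (w : W) => ?_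
    change pullback.fst π (j w) ≫ G ≫ r = pullback.fst π (j w) ≫ ρ
    rw [reassoc_of% hG, hgr]
  · refine Scheme.Cover.hom_ext 𝒰 _ _ fun (w : W) => ?_
    change j w ≫ F ≫ s = j w ≫ t
    rw [reassoc_of% hF, hfs]

end Gluing

/-! ### Uniqueness of classifying morphisms -/

section Uniqueness

variable {A : Type u} [CommRing A] {R : Type u} [CommRing R] [Algebra A R] {n : ℕ} [NeZero n]

theorem familyChart_hom_ext {x : Fin n → R} {F : Type u} [CommRing F]
    {χ χ' : FamilyChart A x →+* F} (h : χ.comp (chartHom A x) = χ'.comp (chartHom A x))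
    (h' : χ.comp (chartCoproj A x) = χ'.comp (chartCoproj A x)) : χ = χ' := by
  refine RingHom.ext fun z => ?_
  obtain ⟨c, rfl⟩ := exists_sum_chartCoproj A x z
  have h1 (a) : χ (chartHom A x a) = χ' (chartHom A x a) := RingHom.congr_fun h a
  have h2 (a) : χ (chartCoproj A x a) = χ' (chartCoproj A x a) := RingHom.congr_fun h' a
  simp only [map_sum, map_mul, h1, h2]

/-- Over a chart, `ℛ₊(α²(x))` is generated by the base chart and the image of `R`; the claim is
local on the source. -/
theorem hom_ext_zPlus {X : Scheme.{u}} (g g' : X ⟶ (zPlus A R n).toScheme)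
    (h : g ≫ zPlusToUPlus A R n = g' ≫ zPlusToUPlus A R n)
    (h' : g ≫ zPlusToSpec A R n = g' ≫ zPlusToSpec A R n) : g = g' := by
  refine hom_ext_of_affine g g' fun w => ?_
  obtain ⟨x, hx⟩ := exists_mem_opensRange_baseι ((g ≫ zPlusToUPlus A R n) w)
  refine ⟨(g ≫ zPlusToUPlus A R n) ⁻¹ᵁ (baseι A x).opensRange, hx, fun C j _ hj => ?_⟩
  have hj' : Set.range (j ≫ g ≫ zPlusToUPlus A R n) ⊆ Set.range (baseι A x) := by
    rintro _ ⟨v, rfl⟩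
    exact hj ⟨v, rfl⟩
  let a := IsOpenImmersion.lift (baseι A x) (j ≫ g ≫ zPlusToUPlus A R n) hj'
  have ha : a ≫ baseι A x = j ≫ g ≫ zPlusToUPlus A R n := IsOpenImmersion.lift_fac ..
  obtain ⟨b, hb, hba⟩ := (isPullback_familyι (A := A) x).exists_lift (j ≫ g) a (by
    rw [ha, Category.assoc])
  obtain ⟨b', hb', hba'⟩ := (isPullback_familyι (A := A) x).exists_lift (j ≫ g') a (by
    rw [ha, Category.assoc, h])
  obtain ⟨β, rfl⟩ := Spec.map_surjective b
  obtain ⟨β', rfl⟩ := Spec.map_surjective b'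
  rw [← hb, ← hb']
  congr 2
  refine CommRingCat.hom_ext (familyChart_hom_ext ?_ ?_)
  · have := hba.trans hba'.symm
    rw [← Spec.map_comp, ← Spec.map_comp] at this
    exact congrArg CommRingCat.Hom.hom (Spec.map_injective this)
  · have : Spec.map β ≫ familyι A x ≫ zPlusToSpec A R n =
        Spec.map β' ≫ familyι A x ≫ zPlusToSpec A R n := by
      rw [reassoc_of% hb, reassoc_of% hb', h']
    rw [familyι_zPlusToSpec, ← Spec.map_comp, ← Spec.map_comp] at this
    exact congrArg CommRingCat.Hom.hom (Spec.map_injective this)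

theorem isPushout_of_isPullback_SpecMap {A' B' C' P' : CommRingCat.{u}} {f : A' ⟶ B'} {g : A' ⟶ C'}
    {inl : B' ⟶ P'} {inr : C' ⟶ P'}
    (h : IsPullback (Spec.map inl) (Spec.map inr) (Spec.map f) (Spec.map g)) :
    IsPushout f g inl inr :=
  (IsPullback.of_map_of_faithful Scheme.Spec (f := inl.op) (g := inr.op) (h := f.op) (i := g.op)
    h).unop.flip

section

variable {C F : Type u} [CommRing C] [CommRing F] [Algebra C F] {x : Fin n → R} (ρ : R →+* F)

theorem exists_isPushout_of_classifies (φ : BaseChart A x →+* C)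
    (h : Classifies (zPlusToUPlus A R n) (zPlusToSpec A R n)
      (Spec.map (CommRingCat.ofHom (algebraMap C F))) (Spec.map (CommRingCat.ofHom ρ))
      (Spec.map (CommRingCat.ofHom φ) ≫ baseι A x)) :
    ∃ χ : FamilyChart A x →+* F, χ.comp (chartCoproj A x) = ρ ∧
      IsPushout (CommRingCat.ofHom φ) (CommRingCat.ofHom (chartHom A x))
        (CommRingCat.ofHom (algebraMap C F)) (CommRingCat.ofHom χ) := by
  obtain ⟨g, hg, hgρ⟩ := h
  obtain ⟨b, hb, hb'⟩ := (isPullback_familyι (A := A) x).exists_lift g _ (by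
    rw [hg.w, Category.assoc])
  obtain ⟨χ, rfl⟩ := Spec.map_surjective b
  subst hb
  refine ⟨χ.hom, ?_, ?_⟩
  · rw [Category.assoc, familyι_zPlusToSpec, ← Spec.map_comp] at hgρ
    exact congrArg CommRingCat.Hom.hom (Spec.map_injective hgρ)
  · exact isPushout_of_isPullback_SpecMap
      (IsPullback.of_right hg hb' (isPullback_familyι x)).flip

theorem classifies_of_isPushout (φ : BaseChart A x →+* C) (χ : FamilyChart A x →+* F)
    (hχ : χ.comp (chartCoproj A x) = ρ)
    (h : IsPushout (CommRingCat.ofHom φ) (CommRingCat.ofHom (chartHom A x))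
        (CommRingCat.ofHom (algebraMap C F)) (CommRingCat.ofHom χ)) :
    Classifies (zPlusToUPlus A R n) (zPlusToSpec A R n)
      (Spec.map (CommRingCat.ofHom (algebraMap C F))) (Spec.map (CommRingCat.ofHom ρ))
      (Spec.map (CommRingCat.ofHom φ) ≫ baseι A x) := by
  refine ⟨Spec.map (CommRingCat.ofHom χ) ≫ familyι A x,
    (isPullback_SpecMap_of_isPushout _ _ _ _ h).flip.paste_horiz (isPullback_familyι x), ?_⟩
  rw [Category.assoc, familyι_zPlusToSpec, ← Spec.map_comp, ← hχ]
  rfl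

/-- Both tuples map to bases of `F`, so `α²(x') / α²(x)` becomes a unit and the first morphism also
factors through the chart of `x'`. There `eq_of_isPushout_chart` applies. -/
theorem eq_of_classifies_chart {x' : Fin n → R} {φ : BaseChart A x →+* C}
    {φ' : BaseChart A x' →+* C}
    (h : Classifies (zPlusToUPlus A R n) (zPlusToSpec A R n)
      (Spec.map (CommRingCat.ofHom (algebraMap C F))) (Spec.map (CommRingCat.ofHom ρ))
      (Spec.map (CommRingCat.ofHom φ) ≫ baseι A x))
    (h' : Classifies (zPlusToUPlus A R n) (zPlusToSpec A R n)
      (Spec.map (CommRingCat.ofHom (algebraMap C F))) (Spec.map (CommRingCat.ofHom ρ))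
      (Spec.map (CommRingCat.ofHom φ') ≫ baseι A x')) :
    Spec.map (CommRingCat.ofHom φ) ≫ baseι A x = Spec.map (CommRingCat.ofHom φ') ≫ baseι A x' := by
  obtain ⟨χ, hχ, hp⟩ := exists_isPushout_of_classifies ρ φ h
  obtain ⟨χ', hχ', hp'⟩ := exists_isPushout_of_classifies ρ φ' h'
  obtain ⟨e', he', -⟩ := exists_basis_of_isPushout_chart ρ φ' χ' hχ' hp'
  have hu := isUnit_chartFrac_of_isPushout ρ φ χ hχ hp e' he'
  have hr : Set.range (Spec.map (CommRingCat.ofHom φ) ≫ baseι A x) ⊆ Set.range (baseι A x') := by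
    rintro _ ⟨v, rfl⟩
    have : Spec.map (CommRingCat.ofHom φ) v ∈ baseι A x ⁻¹ᵁ (baseι A x').opensRange := by
      rw [baseι_preimage]
      change φ (chartFrac A x x') ∉ v.asIdeal
      exact fun hv => v.isPrime.ne_top (Ideal.eq_top_of_isUnit_mem _ hv hu)
    exact this
  have hl := IsOpenImmersion.lift_fac (baseι A x')
    (Spec.map (CommRingCat.ofHom φ) ≫ baseι A x) hr
  obtain ⟨ψ, hψ⟩ := Spec.map_surjective (IsOpenImmersion.lift (baseι A x')
    (Spec.map (CommRingCat.ofHom φ) ≫ baseι A x) hr)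
  rw [← hψ] at hl
  rw [← hl] at h ⊢
  obtain ⟨χ'', hχ'', hp''⟩ := exists_isPushout_of_classifies ρ ψ.hom h
  congr 2
  exact CommRingCat.hom_ext (eq_of_isPushout_chart ρ hχ'' hχ' hp'' hp')

end

/-- The family over a chart is a morphism of affine schemes, so its base change `π` is affine and
`X` is a spectrum. -/
theorem exists_algebra_of_classifies {x : Fin n → R} {C : CommRingCat.{u}} {X : Scheme.{u}}
    {π : X ⟶ Spec C} {ρ : X ⟶ Spec (.of R)} {a : Spec C ⟶ Spec (.of (BaseChart A x))}
    (h : Classifies (zPlusToUPlus A R n) (zPlusToSpec A R n) π ρ (a ≫ baseι A x)) :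
    ∃ (F : Type u) (_ : CommRing F) (_ : Algebra C F) (e : Spec (.of F) ⟶ X), IsIso e ∧
      e ≫ π = Spec.map (CommRingCat.ofHom (algebraMap C F)) := by
  obtain ⟨g, hg, -⟩ := h
  obtain ⟨b, hb, hb'⟩ := (isPullback_familyι (A := A) x).exists_lift g _ (by
    rw [hg.w, Category.assoc])
  subst hb
  have : IsAffineHom π := MorphismProperty.of_isPullback
    (IsPullback.of_right hg hb' (isPullback_familyι x)) inferInstance
  have : IsAffine X := isAffine_of_isAffineHom π
  obtain ⟨ψ, hψ⟩ := Spec.map_surjective (X.isoSpec.inv ≫ π)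
  exact ⟨Γ(X, ⊤), inferInstance, ψ.hom.toAlgebra, X.isoSpec.inv, inferInstance, hψ.symm⟩

/-- The morphism along which a family is a pull-back of the universal family is unique. -/
theorem eq_of_classifies {X W : Scheme.{u}} {π : X ⟶ W} {ρ : X ⟶ Spec (.of R)}
    {f f' : W ⟶ (uPlus A R n).toScheme}
    (h : Classifies (zPlusToUPlus A R n) (zPlusToSpec A R n) π ρ f)
    (h' : Classifies (zPlusToUPlus A R n) (zPlusToSpec A R n) π ρ f') : f = f' := by
  refine hom_ext_of_affine f f' fun w => ?_
  obtain ⟨x, hx⟩ := exists_mem_opensRange_baseι (f w)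
  obtain ⟨x', hx'⟩ := exists_mem_opensRange_baseι (f' w)
  refine ⟨f ⁻¹ᵁ (baseι A x).opensRange ⊓ f' ⁻¹ᵁ (baseι A x').opensRange, ⟨hx, hx'⟩,
    fun C j _ hj => ?_⟩
  have key (f : W ⟶ (uPlus A R n).toScheme) (x : Fin n → R)
      (hr : ∀ v ∈ Set.range j, f v ∈ (baseι A x).opensRange) :
      ∃ φ : BaseChart A x →+* C, Spec.map (CommRingCat.ofHom φ) ≫ baseι A x = j ≫ f := by
    have hr' : Set.range (j ≫ f) ⊆ Set.range (baseι A x) := by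
      rintro _ ⟨v, rfl⟩
      exact hr _ ⟨v, rfl⟩
    obtain ⟨φ, hφ⟩ := Spec.map_surjective (IsOpenImmersion.lift (baseι A x) (j ≫ f) hr')
    refine ⟨φ.hom, ?_⟩
    have := IsOpenImmersion.lift_fac (baseι A x) (j ≫ f) hr'
    rwa [← hφ] at this
  obtain ⟨φ, hφ⟩ := key f x fun v hv => (hj hv).1
  obtain ⟨φ', hφ'⟩ := key f' x' fun v hv => (hj hv).2
  have hp := IsPullback.of_hasPullback π j
  have H := h.of_isPullback hp
  rw [← hφ] at H
  obtain ⟨F, _, _, e, _, he⟩ := exists_algebra_of_classifies H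
  -- Transport along the isomorphism `e` puts the restricted family in the form `Spec F → Spec C`.
  have hpe := (IsPullback.of_horiz_isIso (fst := e) (snd := Spec.map (CommRingCat.ofHom
    (algebraMap C F))) (f := pullback.snd π j) (g := 𝟙 _) ⟨by simpa using he⟩).paste_horiz hp
  obtain ⟨σ, hσ⟩ := Spec.map_surjective ((e ≫ pullback.fst π j) ≫ ρ)
  have H1 := h.of_isPullback hpe
  have H2 := h'.of_isPullback hpe
  rw [← hσ, Category.id_comp] at H1 H2
  rw [← hφ] at H1 ⊢
  rw [← hφ'] at H2 ⊢
  exact eq_of_classifies_chart σ.hom H1 H2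

end Uniqueness

/-! ### Discriminants and determinants under base change -/

section BaseChange

/-- Arguments in the spanning set are replaced by arbitrary vectors one slot at a time, by linearity
in that slot. -/
theorem multilinearMap_mem_of_span {ι C M N : Type*} [Fintype ι] [CommRing C] [AddCommGroup M]
    [Module C M] [AddCommGroup N] [Module C N] (f : MultilinearMap C (fun _ : ι => M) N)
    {s : Set M} (hs : Submodule.span C s = ⊤) (J : Submodule C N)
    (h : ∀ v : ι → M, (∀ i, v i ∈ s) → f v ∈ J) (v : ι → M) : f v ∈ J := by
  classical
  have key (t : Finset ι) : ∀ v : ι → M, (∀ i ∉ t, v i ∈ s) → f v ∈ J := by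
    induction t using Finset.induction_on with
    | empty => exact fun v hv => h v fun i => hv i (Finset.notMem_empty i)
    | insert a t _ ih =>
      intro v hv
      have hle : Submodule.span C s ≤ J.comap (f.toLinearMap v a) := by
        refine Submodule.span_le.mpr fun m hm => ih _ fun i hi => ?_
        rcases eq_or_ne i a with rfl | hia
        · simpa using hm
        · rw [Function.update_of_ne hia]
          exact hv i (by simp [hia, hi])
      have := hle (hs ▸ Submodule.mem_top : v a ∈ Submodule.span C s)
      simpa using this
  exact key Finset.univ v fun i hi => absurd (Finset.mem_univ i) hi

variable {C F : Type u} [CommRing C] [CommRing F] [Algebra C F] {n : ℕ}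

/-- The value `e.det e = 1` lies in the ideal, since by multilinearity it is a combination of
determinants of tuples from the spanning set. -/
theorem span_range_det_eq_top {R : Type*} (ρ : R → F) (e : Module.Basis (Fin n) C F)
    (hρ : Submodule.span C (Set.range ρ) = ⊤) :
    Ideal.span (Set.range fun x : Fin n → R => e.det fun i => ρ (x i)) = ⊤ := by
  rw [Ideal.eq_top_iff_one, ← e.det_self]
  refine multilinearMap_mem_of_span e.det.toMultilinearMap hρ _ (fun v hv => ?_) e
  choose x hx using hv
  exact Ideal.subset_span ⟨x, congrArg e.det (funext hx)⟩

variable (C' : Type u) [CommRing C'] [Algebra C C']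

theorem trace_one_tmul (e : Module.Basis (Fin n) C F) (z : F) :
    Algebra.trace C' (C' ⊗[C] F) (1 ⊗ₜ z) = algebraMap C C' (Algebra.trace C F z) := by
  have := Module.Free.of_basis e
  have := Module.Finite.of_basis e
  rw [Algebra.trace_apply, Algebra.trace_apply, ← LinearMap.trace_baseChange]
  congr 1
  ext w
  simp

theorem discr_baseChange (e : Module.Basis (Fin n) C F) :
    Algebra.discr C' (e.baseChange C') = algebraMap C C' (Algebra.discr C e) := by
  rw [Algebra.discr_def, Algebra.discr_def, RingHom.map_det]
  congr 1
  ext i j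
  simp only [Algebra.traceMatrix_apply, Algebra.traceForm_apply, RingHom.mapMatrix_apply,
    Matrix.map_apply, Module.Basis.baseChange_apply, Algebra.TensorProduct.tmul_mul_tmul, mul_one]
  exact trace_one_tmul C' e _

theorem det_baseChange (e : Module.Basis (Fin n) C F) (v : Fin n → F) :
    (e.baseChange C').det (fun i => 1 ⊗ₜ v i) = algebraMap C C' (e.det v) := by
  rw [Module.Basis.det_apply, Module.Basis.det_apply, RingHom.map_det]
  congr 1
  ext i j
  simp [Module.Basis.toMatrix_apply, Algebra.algebraMap_eq_smul_one]

/-- The two discriminants differ by the square of the invertible change-of-basis determinant. -/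
theorem discr_mem_nonZeroDivisors (e e' : Module.Basis (Fin n) C F)
    (h : Algebra.discr C e ∈ nonZeroDivisors C) : Algebra.discr C e' ∈ nonZeroDivisors C := by
  rw [← e.toMatrix_map_vecMul e', Algebra.discr_of_matrix_vecMul, ← e.det_apply]
  exact mul_mem (((e.isUnit_det e').pow 2).mem_nonZeroDivisors) h

end BaseChange

/-! ### Existence of classifying morphisms -/

section Existence

variable {A : Type u} [CommRing A] {R : Type u} [CommRing R] [Algebra A R] {n : ℕ} [NeZero n]
  {C F : Type u} [CommRing C] [CommRing F] [Algebra A C] [Algebra C F] (ρ : R →+* F)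

variable (A n C) in
/-- The family `Spec F → Spec C`, together with `Spec F → Spec R`, is a pull-back of the universal
family along a morphism over `Spec A`. -/
def IsClassified : Prop := ∃ f : Spec (.of C) ⟶ (uPlus A R n).toScheme,
  Classifies (zPlusToUPlus A R n) (zPlusToSpec A R n)
    (Spec.map (CommRingCat.ofHom (algebraMap C F))) (Spec.map (CommRingCat.ofHom ρ)) f ∧
  f ≫ uPlusToBase A R n = Spec.map (CommRingCat.ofHom (algebraMap A C))

theorem isClassified_of_basis
    (hρ : ∀ a : A, ρ (algebraMap A R a) = algebraMap C F (algebraMap A C a))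
    (e : Module.Basis (Fin n) C F) {x : Fin n → R} (he : ∀ i, e i = ρ (x i))
    (hd : Algebra.discr C e ∈ nonZeroDivisors C) : IsClassified A n C ρ := by
  let : Algebra A F := ((algebraMap C F).comp (algebraMap A C)).toAlgebra
  have : IsScalarTower A C F := IsScalarTower.of_algebraMap_eq fun _ => rfl
  let ρ' : R →ₐ[A] F := { ρ with commutes' := hρ }
  obtain ⟨φ, hφ, hφA⟩ := exists_baseChart_hom ρ' e he hd
  obtain ⟨χ, hχ, hp⟩ := exists_familyChart_hom ρ φ e he hφ
  refine ⟨_, classifies_of_isPushout ρ φ χ hχ hp, ?_⟩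
  rw [Category.assoc, baseι_uPlusToBase, ← Spec.map_comp, ← CommRingCat.ofHom_comp]
  congr 2
  exact RingHom.ext hφA

variable {ρ} in
-- Compatibility on overlaps is automatic from `eq_of_classifies` and `hom_ext_zPlus`, so only local
-- existence is needed.
theorem isClassified_of_localizations
    (h : ∀ v : PrimeSpectrum C, ∃ c ∉ v.asIdeal, IsClassified A n (Localization.Away c)
      ((Algebra.TensorProduct.includeRight : F →ₐ[C] Localization.Away c ⊗[C] F).toRingHom.comp
        ρ)) : IsClassified A n C ρ := by
  refine exists_classifies_of_local (fun g g' => hom_ext_zPlus g g')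
    (fun h h' => eq_of_classifies h h') (uPlusToBase A R n) _ _ _ fun v => ?_
  obtain ⟨c, hc, f, hf, hfA⟩ := h v
  refine ⟨_, _, Spec.map (CommRingCat.ofHom (algebraMap C (Localization.Away c))), _, _, f,
    inferInstance, ?_, (isPullback_SpecMap_of_isPushout _ _ _ _
      (CommRingCat.isPushout_tensorProduct C (Localization.Away c) F)).flip, ?_, ?_⟩
  · exact (PrimeSpectrum.localization_away_comap_range (Localization.Away c) c).ge hc
  · rw [← Spec.map_comp]
    exact hf
  · rw [hfA, ← Spec.map_comp, ← CommRingCat.ofHom_comp, ← IsScalarTower.algebraMap_eq]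

theorem isClassified_of_span
    (hρ : ∀ a : A, ρ (algebraMap A R a) = algebraMap C F (algebraMap A C a))
    (hs : Submodule.span C (Set.range ρ) = ⊤) (e : Module.Basis (Fin n) C F)
    (hd : Algebra.discr C e ∈ nonZeroDivisors C) : IsClassified A n C ρ := by
  refine isClassified_of_localizations fun v => ?_
  -- The determinants of tuples from `R` generate the unit ideal, so one of them is not in `v`.
  obtain ⟨_, ⟨x, rfl⟩, hx⟩ := Set.not_subset.mp fun h => v.isPrime.ne_top
    (top_le_iff.mp ((span_range_det_eq_top ρ e hs).ge.trans (Ideal.span_le.mpr h)))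
  refine ⟨_, hx, ?_⟩
  set c := e.det fun i => ρ (x i) with hc
  let C' := Localization.Away c
  -- Inverting this determinant makes the images of the `x i` a basis.
  have hu : IsUnit ((e.baseChange C').det fun i => (1 : C') ⊗ₜ[C] ρ (x i)) := by
    rw [det_baseChange]
    exact IsLocalization.Away.algebraMap_isUnit c
  obtain ⟨hli, hsp⟩ := (e.baseChange C').is_basis_iff_det.mpr hu
  refine isClassified_of_basis _ (fun a => ?_) (Module.Basis.mk hli hsp.ge) (x := x)
    (fun i => by rw [Module.Basis.mk_apply]; rfl) (discr_mem_nonZeroDivisors (e.baseChange C') _ ?_)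
  · rw [RingHom.comp_apply, hρ]
    change Algebra.TensorProduct.includeRight (algebraMap C F (algebraMap A C a)) = _
    rw [AlgHom.commutes, IsScalarTower.algebraMap_apply A C C']
    rfl
  · rw [discr_baseChange]
    exact IsLocalization.nonZeroDivisors_le_comap (Submonoid.powers c) C' hd

theorem isClassified_of_isGenericallyEtale
    (hρ : ∀ a : A, ρ (algebraMap A R a) = algebraMap C F (algebraMap A C a))
    (hs : Submodule.span C (Set.range ρ) = ⊤) (hF : IsGenericallyEtale n C F) :
    IsClassified A n C ρ := by
  obtain ⟨s, hs1, hb⟩ := hF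
  refine isClassified_of_localizations fun v => ?_
  obtain ⟨b, hbs, hbv⟩ := Set.not_subset.mp fun h => v.isPrime.ne_top
    (top_le_iff.mp (hs1.ge.trans (Ideal.span_le.mpr h)))
  obtain ⟨e, he⟩ := hb b hbs
  refine ⟨b, hbv, isClassified_of_span _ (fun a => ?_) ?_ e he⟩
  · rw [RingHom.comp_apply, hρ]
    change Algebra.TensorProduct.includeRight (algebraMap C F (algebraMap A C a)) = _
    rw [AlgHom.commutes, IsScalarTower.algebraMap_apply A C (Localization.Away b)]
    rfl
  -- The image of `R` still spans after localization.
  · have := Submodule.baseChange_span (A := Localization.Away b) (R := C) (Set.range ρ)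
    rw [hs, Submodule.baseChange_top, ← Set.range_comp] at this
    exact this.symm

end Existence

end GenericallyEtale

end

theorem mainTheorem6 (A R B E : Type u) [CommRing A] [CommRing R] [CommRing B] [CommRing E]
    [Algebra A R] [Algebra A B] [Algebra B E] (n : ℕ) [NeZero n]
    (q : B ⊗[A] R →ₐ[B] E) (hq : Function.Surjective q)
    (hE : GenericallyEtale.IsGenericallyEtale n B E) :
    GenericallyEtale.uPlus A R n = ⊤ ∧
    ∃ f : Spec (.of B) ⟶ (GenericallyEtale.uPlus A R n).toScheme,
      f ≫ GenericallyEtale.uPlusToBase A R n =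
        Spec.map (CommRingCat.ofHom (algebraMap A B)) ∧
      GenericallyEtale.PullsBackTo A R n
        (q.toRingHom.comp (Algebra.TensorProduct.includeRight : R →ₐ[A] B ⊗[A] R).toRingHom) f ∧
      ∀ f' : Spec (.of B) ⟶ (GenericallyEtale.uPlus A R n).toScheme,
        GenericallyEtale.PullsBackTo A R n
          (q.toRingHom.comp
            (Algebra.TensorProduct.includeRight : R →ₐ[A] B ⊗[A] R).toRingHom) f' →
        f' = f := by
  -- The elements `1 ⊗ r` span `B ⊗[A] R` over `B`, and `q` is surjective; this is where `E` being a
  -- quotient enters.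
  have hspan : Submodule.span B (Set.range (q.toRingHom.comp
      (Algebra.TensorProduct.includeRight : R →ₐ[A] B ⊗[A] R).toRingHom)) = ⊤ := by
    have h := congrArg (Submodule.map q.toLinearMap)
      (Submodule.baseChange_span (A := B) (R := A) (Set.univ : Set R))
    rw [Submodule.span_univ, Submodule.baseChange_top, Submodule.map_top,
      LinearMap.range_eq_top.mpr hq, Submodule.map_span, Set.image_univ, ← Set.range_comp] at h
    exact h.symm
  obtain ⟨f, hf, hfA⟩ := GenericallyEtale.isClassified_of_isGenericallyEtale (A := A) (C := B)
    (q.toRingHom.comp (Algebra.TensorProduct.includeRight : R →ₐ[A] B ⊗[A] R).toRingHom)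
    (fun a => by
      change q (Algebra.TensorProduct.includeRight (algebraMap A R a)) = _
      rw [AlgHom.commutes, IsScalarTower.algebraMap_apply A B (B ⊗[A] R), AlgHom.commutes])
    hspan hE
  exact ⟨GenericallyEtale.uPlus_eq_top A R n, f, hfA, hf,
    fun f' hf' => GenericallyEtale.eq_of_classifies hf' hf⟩
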